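/- For a probability measure $\mu$ on $\mathbb{R}$, let $C_{\mathrm{LS}}(\mu)\in[0,\infty]$ be the best (smallest) constant $C$ such that $$\operatorname{Ent}_\mu(h^2):=\int h^2\log(h^2)\,d\mu-\Big(\int h^2\,d\mu\Big)\log\Big(\int h^2\,d\mu\Big)\le 2C\int |h'|^2\,d\mu$$ for all smooth compactly supported $h:\mathbb{R}\to\mathbb{R}$ (with $0\log 0=0$, and $C_{\mathrm{LS}}(\mu)=\infty$ if there is no such $C$). Let $f(x)=\frac12\operatorname{dist}\big(x,[-\frac\pi2,\frac\pi2]\big)^2$ for $x\in\mathbb{R}$. For $t>0$ let $\mu_t$ be the probability measure with density $\frac1{Z_t}e^{-f/t}$, where $Z_t=\int_{\mathbb{R}} e^{-f(x)/t}\,dx$, and let $\mu_0$ be the uniform probability measure on $[-\frac\pi2,\frac\pi2]$. Then $C_{\mathrm{LS}}(\mu_0)<\infty$ and, as $t\to0^+$, $$C_{\mathrm{LS}}(\mu_t)\ \ge\ C_{\mathrm{LS}}(\mu_0)+\sqrt{\frac{8t}{\pi}}+o(\sqrt t).$$ This disproves the conjecture of Chewi and Stromme, according to which $\frac{C_{\mathrm{LS}}(\mu_t)-C_{\mathrm{LS}}(\mu_0)}{t}\to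 2C_{PL}$ as $t\to0^+$ whenever the potential $f$ satisfies a Polyak–Łojasiewicz inequality $f-\inf f\le C|f'|^2$, with best constant $C_{PL}$, and $\mu_t$ converges weakly to a probability measure $\mu_0$: the potential $f$ above is $C^1$ and satisfies the Polyak–Łojasiewicz inequality with best constant $C_{PL}=\frac12$, and $\mu_t\to\mu_0$ weakly as $t\to0^+$, but $$\frac{C_{\mathrm{LS}}(\mu_t)-C_{\mathrm{LS}}(\mu_0)}{t}\longrightarrow+\infty ,$$ so this quotient does not converge to $2C_{PL}=1$. -/

import Mathlib

open MeasureTheory ProbabilityTheory Filter Topology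
open scoped ContDiff

noncomputable section

/-- `Ent_μ(h²) = ∫ h² log h² dμ - (∫ h² dμ) log (∫ h² dμ)`, with `0 log 0 = 0`
(which is Mathlib's convention `Real.log 0 = 0`). -/
def entSq (μ : Measure ℝ) (h : ℝ → ℝ) : ℝ :=
  (∫ x, h x ^ 2 * Real.log (h x ^ 2) ∂μ) - (∫ x, h x ^ 2 ∂μ) * Real.log (∫ x, h x ^ 2 ∂μ)

/-- `μ` satisfies the log-Sobolev inequality with constant `C`:
`Ent_μ(h²) ≤ 2 C ∫ |h'|² dμ` for every smooth compactly supported `h : ℝ → ℝ`. -/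
def SatisfiesLSI (μ : Measure ℝ) (C : ℝ) : Prop :=
  ∀ h : ℝ → ℝ, ContDiff ℝ ∞ h → HasCompactSupport h →
    entSq μ h ≤ 2 * C * ∫ x, deriv h x ^ 2 ∂μ

/-- The best constant in the log-Sobolev inequality, an extended real number: it is `⊤` exactly
when the inequality holds with no finite constant. -/
def logSobolevConst (μ : Measure ℝ) : EReal :=
  ⨅ (C : ℝ) (_ : SatisfiesLSI μ C), (C : EReal)

/-- The Gibbs measure with density `exp (-V / t) / Z_t`, where `Z_t = ∫ exp (-V / t)`. -/
def gibbs (V : ℝ → ℝ) (t : ℝ) : Measure ℝ :=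
  volume.withDensity fun x =>
    ENNReal.ofReal (Real.exp (-V x / t) / ∫ y, Real.exp (-V y / t))

/-- The interval `[-π/2, π/2]`. -/
def segment₀ : Set ℝ := Set.Icc (-(Real.pi / 2)) (Real.pi / 2)

/-- The potential `x ↦ ½ dist(x, [-π/2, π/2])²`. -/
def halfSqDist (x : ℝ) : ℝ := 1 / 2 * Metric.infDist x segment₀ ^ 2

/-- The uniform probability measure on `[-π/2, π/2]`: Lebesgue measure conditioned on it. -/
def uniform₀ : Measure ℝ := cond volume segment₀

/-- The Polyak–Łojasiewicz inequality `V - inf V ≤ C |V'|²`. -/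
def SatisfiesPL (V : ℝ → ℝ) (C : ℝ) : Prop :=
  ∀ x, V x - (⨅ y, V y) ≤ C * deriv V x ^ 2

end

/-! The proof compares two explicit bounds: `logSobolevConst uniform₀ ≤ 1`, and `1 + √(8t/π) ≤
logSobolevConst (gibbs halfSqDist t)` for every `t > 0`. The gap has order `√t`, so dividing by `t`
makes it blow up. No lower bound on the constant of the uniform measure is needed.

Lower bound (`SatisfiesLSI.one_add_sqrt_le`). Linearizing a log-Sobolev inequality at the constant
function 1 gives a Poincaré inequality with the same constant. Test it on `sin` stopped at `±π/2`.
Off the segment this function is `±1`, so the Gaussian tails, of unnormalized mass `√(2πt)`, add to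
the variance but nothing to the energy. The ratio is `(π/2 + √(2πt)) / (π/2)`.

Upper bound (`satisfiesLSI_uniform₀`). Run the Neumann heat flow on `[0, π]` from a positive density
`p`. Entropy minus half the Fisher information is nondecreasing in time
(`entropy_sub_fisher_dissipation_nonneg`), because `sin` is the Dirichlet ground state on `[0, π]`
with eigenvalue 1. Dropping the Fisher term at later times, and letting time go to infinity, bounds
the initial value by the entropy of the mean. For cosine polynomials the flow is a finite explicit
sum, so no parabolic theory enters. Polynomials in `sin` on the segment become cosine polynomials
after a shift by `π/2`, and they approximate smooth functions well enough to pass to the limit. -/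

/-! ### Dissipation along the Neumann heat flow -/

/-- Along the heat flow with Neumann boundary conditions on `[0, π]`, the quantity
`∫ p log p - ½ ∫ p'² / p` has nonnegative time derivative. -/
lemma entropy_sub_fisher_dissipation_nonneg {p p₁ p₂ p₃ q q₁ : ℝ → ℝ} (hp : ∀ x, 0 < p x)
    (h₀ : ∀ x, HasDerivAt p (p₁ x) x) (h₁ : ∀ x, HasDerivAt p₁ (p₂ x) x)
    (h₂ : ∀ x, HasDerivAt p₂ (p₃ x) x) (h₃ : Continuous p₃)
    (hq : ∀ x, p₁ x = q x * Real.sin x) (hq₁ : ∀ x, HasDerivAt q (q₁ x) x)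
    (hq₁c : Continuous q₁) :
    0 ≤ ∫ x in (0 : ℝ)..Real.pi, (p₂ x * (Real.log (p x) + 1) - p₁ x * p₃ x / p x
      + p₁ x ^ 2 * p₂ x / (2 * p x ^ 2)) := by
  have hne : ∀ x, p x ≠ 0 := fun x => (hp x).ne'
  have c₀ : Continuous p := continuous_iff_continuousAt.2 fun x => (h₀ x).continuousAt
  have c₁ : Continuous p₁ := continuous_iff_continuousAt.2 fun x => (h₁ x).continuousAt
  have c₂ : Continuous p₂ := continuous_iff_continuousAt.2 fun x => (h₂ x).continuousAt
  have cq : Continuous q := continuous_iff_continuousAt.2 fun x => (hq₁ x).continuousAt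
  have hp₂ : ∀ x, p₂ x = q₁ x * Real.sin x + q x * Real.cos x := fun x => by
    have := (hq₁ x).mul (Real.hasDerivAt_sin x)
    have e : p₁ = q * Real.sin := funext hq
    exact (h₁ x).unique (e ▸ this)
  -- With `f = p'/√p = q sin/√p`, the first term of `N` is `sin² ((f/sin)')²`, which integrates to
  -- `∫ f'² - f²`: this is the ground state substitution. The second term is what remains when `∫ p
  -- ((log p)'')²` is rewritten as `∫ f'² + p'⁴/(12 p³)`.
  set N : ℝ → ℝ := fun x => Real.sin x ^ 2 * (q₁ x - q x * p₁ x / (2 * p x)) ^ 2 / p x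
    + p₁ x ^ 4 / (12 * p x ^ 3) with hN
  set G : ℝ → ℝ := fun x => p₂ x * (Real.log (p x) + 1) - p₁ x * p₃ x / p x
      + p₁ x ^ 2 * p₂ x / (2 * p x ^ 2) with hG
  have hlog : Continuous fun x => Real.log (p x) := c₀.log hne
  have cN : Continuous N := by
    refine (Continuous.div (by fun_prop (disch := simp [hne])) c₀ hne).add
      (Continuous.div (by fun_prop) (by fun_prop) fun x => by simp [hne])
  have cG : Continuous G := by
    refine ((c₂.mul (hlog.add continuous_const)).sub ((c₁.mul h₃).div c₀ hne)).add
      (((c₁.pow 2).mul c₂).div (by fun_prop) fun x => by simp [hne])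
  -- Collects the boundary terms of all the integrations by parts at once, so that `G = N + B'`.
  -- Each term has a factor `p₁ = q sin` or `sin`, hence vanishes at `0` and `π`.
  set B : ℝ → ℝ := fun x => p₁ x * (Real.log (p x) + 1) - p₁ x * p₂ x / p x
    + p₁ x ^ 3 / (6 * p x ^ 2) + q x ^ 2 * (Real.sin x * Real.cos x) / p x with hB
  have hBd : ∀ x, HasDerivAt B (G x - N x) x := fun x => by
    have d := ((((h₁ x).mul (((h₀ x).log (hne x)).add_const 1)).sub
      (((h₁ x).mul (h₂ x)).div (h₀ x) (hne x))).add
      (((h₁ x).pow 3).div (((h₀ x).pow 2).const_mul 6) (by simp [hne]))).add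
      ((((hq₁ x).pow 2).mul ((Real.hasDerivAt_sin x).mul (Real.hasDerivAt_cos x))).div
        (h₀ x) (hne x))
    refine d.congr_deriv ?_
    have hx := hne x
    simp only [hG, hN, hq x, hp₂ x, Pi.pow_apply, Pi.mul_apply]
    field_simp
    ring
  have key := intervalIntegral.integral_eq_sub_of_hasDerivAt (f := B) (a := 0) (b := Real.pi)
    (fun x _ => hBd x) ((cG.sub cN).intervalIntegrable _ _)
  have hB0 : B Real.pi - B 0 = 0 := by simp [hB, hq]
  rw [hB0, intervalIntegral.integral_sub (cG.intervalIntegrable _ _)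
    (cN.intervalIntegrable _ _), sub_eq_zero] at key
  rw [key]
  refine intervalIntegral.integral_nonneg Real.pi_pos.le fun x _ => ?_
  have := hp x
  simp only [hN]
  positivity

/-- Differentiation of an integral over a compact interval whose integrand has a jointly
continuous parameter derivative. -/
lemma hasDerivAt_intervalIntegral_of_continuous {F F' : ℝ → ℝ → ℝ} (a b : ℝ)
    (hF : ∀ t, Continuous (F t)) (hF' : Continuous (Function.uncurry F'))
    (hd : ∀ t x, HasDerivAt (fun s => F s x) (F' t x) t) (t : ℝ) :
    HasDerivAt (fun s => ∫ x in a..b, F s x) (∫ x in a..b, F' t x) t := by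
  obtain ⟨M, hM⟩ := ((isCompact_Icc (a := t - 1) (b := t + 1)).prod
    (isCompact_uIcc (a := a) (b := b))).exists_bound_of_continuousOn hF'.continuousOn
  refine (intervalIntegral.hasDerivAt_integral_of_dominated_loc_of_deriv_le (bound := fun _ => M)
    (Icc_mem_nhds (by linarith : t - 1 < t) (by linarith : t < t + 1))
    (Eventually.of_forall fun s => (hF s).aestronglyMeasurable)
    ((hF t).intervalIntegrable _ _) ?_ ?_ intervalIntegrable_const ?_).2
  · exact (hF'.comp (Continuous.prodMk_right t)).aestronglyMeasurable
  · refine Eventually.of_forall fun x hx s hs => hM (s, x) ⟨hs, Set.uIoc_subset_uIcc hx⟩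
  · exact Eventually.of_forall fun x _ s _ => hd s x

/-! ### Cosine polynomials and their heat flow -/

/-- The cosine polynomial `∑ a k cos (k x)`, summed over `k < n`. -/
noncomputable def cosSum (n : ℕ) (a : ℕ → ℝ) (x : ℝ) : ℝ :=
  ∑ k ∈ Finset.range n, a k * Real.cos (k * x)

/-- The sine polynomial `∑ a k sin (k x)`, summed over `k < n`. -/
noncomputable def sinSum (n : ℕ) (a : ℕ → ℝ) (x : ℝ) : ℝ :=
  ∑ k ∈ Finset.range n, a k * Real.sin (k * x)

/-- The coefficients at time `s ^ 2` of the heat flow started from coefficients `a`. -/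
noncomputable def heatCoeff (a : ℕ → ℝ) (s : ℝ) (k : ℕ) : ℝ := a k * Real.exp (-(k ^ 2 * s ^ 2))

lemma hasDerivAt_cosSum (n : ℕ) (a : ℕ → ℝ) (x : ℝ) :
    HasDerivAt (cosSum n a) (sinSum n (fun k => -(a k * k)) x) x := by
  unfold cosSum sinSum
  refine HasDerivAt.fun_sum fun k _ => ?_
  have := (((hasDerivAt_id x).const_mul (k : ℝ)).cos).const_mul (a k)
  refine this.congr_deriv ?_
  simp; ring

lemma hasDerivAt_sinSum (n : ℕ) (a : ℕ → ℝ) (x : ℝ) :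
    HasDerivAt (sinSum n a) (cosSum n (fun k => a k * k) x) x := by
  unfold cosSum sinSum
  refine HasDerivAt.fun_sum fun k _ => ?_
  have := (((hasDerivAt_id x).const_mul (k : ℝ)).sin).const_mul (a k)
  refine this.congr_deriv ?_
  simp; ring

lemma continuous_cosSum (n : ℕ) (a : ℕ → ℝ) : Continuous (cosSum n a) := by
  unfold cosSum; fun_prop

lemma continuous_sinSum (n : ℕ) (a : ℕ → ℝ) : Continuous (sinSum n a) := by
  unfold sinSum; fun_prop

/-- A sine polynomial is `sin` times a polynomial in `cos`. -/
lemma exists_polynomial_sinSum (n : ℕ) (a : ℕ → ℝ) :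
    ∃ Q : Polynomial ℝ, ∀ x, sinSum n a x = Q.eval (Real.cos x) * Real.sin x := by
  refine ⟨∑ k ∈ Finset.range n, Polynomial.C (a k) * Polynomial.Chebyshev.U ℝ ((k : ℤ) - 1),
    fun x => ?_⟩
  simp only [sinSum, Polynomial.eval_finsetSum, Polynomial.eval_mul, Polynomial.eval_C,
    Finset.sum_mul, mul_assoc, Polynomial.Chebyshev.U_real_cos]
  simp

/-- A polynomial in `cos` is a cosine polynomial. -/
lemma exists_cosSum_eq (P : Polynomial ℝ) :
    ∃ (n : ℕ) (a : ℕ → ℝ), ∀ x, P.eval (Real.cos x) = cosSum n a x := by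
  -- The Chebyshev polynomial `T k` has degree exactly `k`, so these span all polynomials, and `T k
  -- (cos x) = cos (k x)`.
  let S : Polynomial.Sequence ℝ :=
    { elems' := fun k => Polynomial.Chebyshev.T ℝ k
      degree_eq' := fun k => by simp }
  have hS : ∀ i, IsUnit (S i).leadingCoeff := fun i =>
    isUnit_iff_ne_zero.2 (Polynomial.leadingCoeff_ne_zero.2 (S.ne_zero i))
  have hP : P ∈ Submodule.span ℝ (Set.range S) := by rw [S.span hS]; trivial
  obtain ⟨c, rfl⟩ := (Finsupp.mem_span_range_iff_exists_finsupp).1 hP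
  refine ⟨c.support.sup id + 1, c, fun x => ?_⟩
  rw [Finsupp.sum_of_support_subset c (s := Finset.range (c.support.sup id + 1))
    (fun k hk => Finset.mem_range.2 (Nat.lt_succ_of_le (Finset.le_sup (f := id) hk))) _
    (fun k _ => by simp)]
  simp only [cosSum, Polynomial.eval_finsetSum, Polynomial.eval_smul, smul_eq_mul]
  refine Finset.sum_congr rfl fun k _ => ?_
  have : S k = Polynomial.Chebyshev.T ℝ k := rfl
  rw [this, Polynomial.Chebyshev.T_real_cos]
  simp

/-- Real part of `exp (ikx)` times the Gaussian characteristic function. It identifies the damping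
of Fourier modes with convolution by the heat kernel, from which positivity of the flow is read off.
-/
lemma integral_cos_mul_gaussianReal (v : NNReal) (k x : ℝ) :
    ∫ y, Real.cos (k * (x + y)) ∂(gaussianReal 0 v)
      = Real.exp (-(k ^ 2 * v / 2)) * Real.cos (k * x) := by
  have h := charFun_gaussianReal (μ := 0) (v := v) k
  rw [charFun_apply_real] at h
  have hint : Integrable (fun y : ℝ => Complex.exp (k * y * Complex.I)) (gaussianReal 0 v) := by
    refine Integrable.of_bound (by fun_prop) 1 (Eventually.of_forall fun y => ?_)
    rw [← Complex.ofReal_mul, Complex.norm_exp_ofReal_mul_I]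
  have h2 : ∀ y : ℝ, Real.cos (k * (x + y))
      = (Complex.exp (k * x * Complex.I) * Complex.exp (k * y * Complex.I)).re := fun y => by
    rw [← Complex.exp_add, ← add_mul, ← mul_add, ← Complex.ofReal_add, ← Complex.ofReal_mul,
      Complex.exp_ofReal_mul_I_re]
  simp_rw [h2]
  have h3 := integral_re (hint.const_mul (Complex.exp (k * x * Complex.I)))
  simp only [RCLike.re_eq_complex_re] at h3
  rw [h3, integral_const_mul, h]
  have h4 : (k * (0 : ℝ) * Complex.I - v * k ^ 2 / 2 : ℂ) = ((-(k ^ 2 * v / 2) : ℝ) : ℂ) := by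
    push_cast; ring
  rw [h4, ← Complex.ofReal_exp, Complex.re_mul_ofReal, ← Complex.ofReal_mul,
    Complex.exp_ofReal_mul_I_re, mul_comm]

/-- The heat flow of a positive cosine polynomial stays positive. -/
lemma cosSum_heatCoeff_pos {n : ℕ} {a : ℕ → ℝ} (h : ∀ x, 0 < cosSum n a x) (s x : ℝ) :
    0 < cosSum n (heatCoeff a s) x := by
  -- The heat kernel at time `s ^ 2` has variance `2 s ^ 2`. Taking `s ^ 2` as the time keeps the
  -- flow positive for every real `s`, so derivatives at `s = 0` are two-sided.
  set v : NNReal := ⟨2 * s ^ 2, by positivity⟩ with hv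
  have hint : ∀ k : ℕ, Integrable (fun y : ℝ => a k * Real.cos (k * (x + y)))
      (gaussianReal 0 v) := fun k => by
    refine Integrable.const_mul (Integrable.of_bound (by fun_prop) 1
      (Eventually.of_forall fun y => Real.abs_cos_le_one _)) _
  have e : cosSum n (heatCoeff a s) x = ∫ y, cosSum n a (x + y) ∂(gaussianReal 0 v) := by
    simp only [cosSum]
    rw [integral_finsetSum _ fun k _ => hint k]
    refine Finset.sum_congr rfl fun k _ => ?_
    rw [integral_const_mul, integral_cos_mul_gaussianReal, heatCoeff, hv]
    rw [mul_assoc]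
    congr 4
    show _ = (k : ℝ) ^ 2 * (2 * s ^ 2) / 2
    ring
  have hi : Integrable (fun y => cosSum n a (x + y)) (gaussianReal 0 v) :=
    integrable_finsetSum _ fun k _ => hint k
  rw [e, integral_pos_iff_support_of_nonneg (fun y => (h _).le) hi]
  have : Function.support (fun y => cosSum n a (x + y)) = Set.univ :=
    Set.eq_univ_of_forall fun y => (h _).ne'
  simp [this]

lemma continuous_heatCoeff (a : ℕ → ℝ) (k : ℕ) : Continuous fun s => heatCoeff a s k := by
  unfold heatCoeff; fun_prop

lemma hasDerivAt_heatCoeff (a : ℕ → ℝ) (k : ℕ) (s : ℝ) :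
    HasDerivAt (fun s => heatCoeff a s k) (2 * s * -(heatCoeff a s k * k * k)) s := by
  have := ((((hasDerivAt_id s).pow 2).const_mul ((k : ℝ) ^ 2)).neg.exp).const_mul (a k)
  refine this.congr_deriv ?_
  simp [heatCoeff]; ring

lemma integral_cosSum (n : ℕ) (a : ℕ → ℝ) (hn : 0 < n) :
    ∫ x in (0 : ℝ)..Real.pi, cosSum n a x = Real.pi * a 0 := by
  unfold cosSum
  rw [intervalIntegral.integral_finsetSum fun k _ =>
    Continuous.intervalIntegrable (by fun_prop) _ _]
  rw [Finset.sum_eq_single 0]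
  · simp
  · intro k _ hk
    have : (k : ℝ) ≠ 0 := by exact_mod_cast hk
    rw [intervalIntegral.integral_const_mul,
      intervalIntegral.integral_comp_mul_left (fun y => Real.cos y) this]
    simp
  · intro h; simp at h; omega

/-! ### Log-Sobolev inequality for positive cosine polynomials -/

/-- Along a positive solution of the heat equation (at time `s ^ 2`), the difference of the entropy
and half of the Fisher information at time zero is at most the entropy at later times. -/
lemma entropy_sub_fisher_le_entropy {p p₁ p₂ p₃ : ℝ → ℝ → ℝ} (pos : ∀ s x, 0 < p s x)
    (cp : Continuous (Function.uncurry p)) (cp₁ : Continuous (Function.uncurry p₁))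
    (cp₂ : Continuous (Function.uncurry p₂)) (cp₃ : Continuous (Function.uncurry p₃))
    (dp : ∀ s x, HasDerivAt (fun s => p s x) (2 * s * p₂ s x) s)
    (dp₁ : ∀ s x, HasDerivAt (fun s => p₁ s x) (2 * s * p₃ s x) s)
    (hdiss : ∀ s, 0 ≤ ∫ x in (0 : ℝ)..Real.pi, (p₂ s x * (Real.log (p s x) + 1)
      - p₁ s x * p₃ s x / p s x + p₁ s x ^ 2 * p₂ s x / (2 * p s x ^ 2))) {s : ℝ} (hs : 0 ≤ s) :
    (∫ x in (0 : ℝ)..Real.pi, (p 0 x * Real.log (p 0 x) - p₁ 0 x ^ 2 / (2 * p 0 x)))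
      ≤ ∫ x in (0 : ℝ)..Real.pi, p s x * Real.log (p s x) := by
  have hne : ∀ s x, p s x ≠ 0 := fun s x => (pos s x).ne'
  set F : ℝ → ℝ → ℝ := fun s x => p s x * Real.log (p s x) - p₁ s x ^ 2 / (2 * p s x) with hF
  set F' : ℝ → ℝ → ℝ := fun s x => 2 * s * (p₂ s x * (Real.log (p s x) + 1)
    - p₁ s x * p₃ s x / p s x + p₁ s x ^ 2 * p₂ s x / (2 * p s x ^ 2)) with hF'
  have hd : ∀ s x, HasDerivAt (fun s => F s x) (F' s x) s := fun s x => by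
    have := ((dp s x).mul ((dp s x).log (hne s x))).sub
      (((dp₁ s x).pow 2).div ((dp s x).const_mul 2) (by simp [hne]))
    refine this.congr_deriv ?_
    have := hne s x
    simp only [hF', Pi.pow_apply]
    field_simp
    ring
  have cF : Continuous (Function.uncurry F) := by
    refine (cp.mul (cp.log fun z => hne _ _)).sub ((cp₁.pow 2).div (continuous_const.mul cp)
      fun z => by simpa using hne _ _)
  have cF' : Continuous (Function.uncurry F') := by
    refine (continuous_const.mul continuous_fst).mul
      (((cp₂.mul ((cp.log fun z => hne _ _).add continuous_const)).sub
        ((cp₁.mul cp₃).div cp fun z => hne _ _)).add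
        (((cp₁.pow 2).mul cp₂).div (continuous_const.mul (cp.pow 2)) fun z => by
          simpa using hne _ _))
  have cFs : ∀ s, Continuous (F s) := fun s => cF.comp (Continuous.prodMk_right s)
  have hK := hasDerivAt_intervalIntegral_of_continuous 0 Real.pi cFs cF' hd
  -- The chain rule factor `2 * s` is nonnegative only for `s ≥ 0`, whence monotonicity on this
  -- half-line.
  have mono : MonotoneOn (fun s => ∫ x in (0 : ℝ)..Real.pi, F s x) (Set.Ici 0) := by
    refine monotoneOn_of_deriv_nonneg (convex_Ici 0)
      (fun s _ => (hK s).continuousAt.continuousWithinAt)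
      (fun s _ => (hK s).differentiableAt.differentiableWithinAt) fun s hs => ?_
    rw [(hK s).deriv]
    simp only [hF', intervalIntegral.integral_const_mul]
    rw [interior_Ici] at hs
    exact mul_nonneg (by have := hs.out; positivity) (hdiss s)
  have cps : Continuous (p s) := cp.comp (Continuous.prodMk_right s)
  -- At the later time the Fisher information is simply discarded.
  refine (mono (Set.mem_Ici.2 le_rfl) hs hs).trans ?_
  refine intervalIntegral.integral_mono_on Real.pi_pos.le ((cFs s).intervalIntegrable _ _)
    ((cps.mul (cps.log (hne s))).intervalIntegrable _ _) fun x _ => ?_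
  have := pos s x
  have : 0 ≤ p₁ s x ^ 2 / (2 * p s x) := by positivity
  simp only [hF]; linarith

/-- The entropy along the heat flow of a cosine polynomial converges to that of its mean. -/
lemma tendsto_entropy_cosSum_heatCoeff {n : ℕ} (hn : 0 < n) (a : ℕ → ℝ) :
    Tendsto (fun s => ∫ x in (0 : ℝ)..Real.pi,
      cosSum n (heatCoeff a s) x * Real.log (cosSum n (heatCoeff a s) x)) atTop
      (𝓝 (∫ _ in (0 : ℝ)..Real.pi, a 0 * Real.log (a 0))) := by
  obtain ⟨M, hM⟩ := (isCompact_Icc (a := -(∑ k ∈ Finset.range n, |a k|))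
    (b := ∑ k ∈ Finset.range n, |a k|)).exists_bound_of_continuousOn
    Real.continuous_mul_log.continuousOn
  refine intervalIntegral.tendsto_integral_filter_of_dominated_convergence (fun _ => M)
    (Eventually.of_forall fun s =>
      (Real.continuous_mul_log.comp (continuous_cosSum n _)).aestronglyMeasurable)
    (Eventually.of_forall fun s => Eventually.of_forall fun x _ => hM (cosSum n _ x) ?_)
    intervalIntegrable_const (Eventually.of_forall fun x _ => ?_)
  · refine abs_le.1 ((Finset.abs_sum_le_sum_abs _ _).trans (Finset.sum_le_sum fun k _ => ?_))
    rw [heatCoeff, abs_mul, abs_mul, mul_assoc]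
    refine mul_le_of_le_one_right (abs_nonneg _)
      (mul_le_one₀ ?_ (abs_nonneg _) (Real.abs_cos_le_one _))
    rw [abs_of_pos (Real.exp_pos _), Real.exp_le_one_iff]
    have : 0 ≤ (k : ℝ) ^ 2 * s ^ 2 := by positivity
    linarith
  · have hpl : Tendsto (fun s => cosSum n (heatCoeff a s) x) atTop (𝓝 (a 0)) := by
      have : a 0 = ∑ k ∈ Finset.range n, if k = 0 then a 0 else 0 := by simp [hn]
      rw [this]
      refine tendsto_finsetSum _ fun k _ => ?_
      split_ifs with hk
      · subst hk; simp [heatCoeff]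
      · have hk' : 0 < (k : ℝ) ^ 2 := by positivity
        have h1 : Tendsto (fun s : ℝ => Real.exp (-((k : ℝ) ^ 2 * s ^ 2))) atTop (𝓝 0) :=
          Real.tendsto_exp_neg_atTop_nhds_zero.comp
            ((tendsto_pow_atTop two_ne_zero).const_mul_atTop hk')
        simpa [heatCoeff] using (h1.const_mul (a k)).mul_const (Real.cos (k * x))
    exact (Real.continuous_mul_log.tendsto (a 0)).comp hpl

/-- The logarithmic Sobolev inequality on `[0, π]` for positive cosine polynomials. -/
lemma cosSum_logSobolev {n : ℕ} {a : ℕ → ℝ} (h : ∀ x, 0 < cosSum n a x) :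
    (∫ x in (0 : ℝ)..Real.pi, (cosSum n a x * Real.log (cosSum n a x)
      - sinSum n (fun k => -(a k * k)) x ^ 2 / (2 * cosSum n a x)))
      ≤ Real.pi * (a 0 * Real.log (a 0)) := by
  have hn : 0 < n := by
    rcases Nat.eq_zero_or_pos n with rfl | hn
    · simpa [cosSum] using h 0
    · exact hn
  have hc := continuous_heatCoeff a
  have hle := fun (s : ℝ) (hs : 0 ≤ s) => entropy_sub_fisher_le_entropy
    (p := fun s => cosSum n (heatCoeff a s))
    (p₁ := fun s => sinSum n (fun k => -(heatCoeff a s k * k)))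
    (p₂ := fun s => cosSum n (fun k => -(heatCoeff a s k * k) * k))
    (p₃ := fun s => sinSum n (fun k => -(-(heatCoeff a s k * k) * k * k)))
    (cosSum_heatCoeff_pos h) (by simp only [Function.uncurry_def, cosSum]; fun_prop)
    (by simp only [Function.uncurry_def, sinSum]; fun_prop)
    (by simp only [Function.uncurry_def, cosSum]; fun_prop)
    (by simp only [Function.uncurry_def, sinSum]; fun_prop)
    (fun s x => by
      simp only [cosSum, Finset.mul_sum]
      refine HasDerivAt.fun_sum fun k _ => ?_
      exact ((hasDerivAt_heatCoeff a k s).mul_const _).congr_deriv (by ring))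
    (fun s x => by
      simp only [sinSum, Finset.mul_sum]
      refine HasDerivAt.fun_sum fun k _ => ?_
      exact (((hasDerivAt_heatCoeff a k s).mul_const _).neg.mul_const _).congr_deriv (by ring))
    (fun s => by
      -- The quotient of the first space derivative by `sin` is the smooth function `Q (cos x)`, so
      -- it causes no singularity at the endpoints.
      obtain ⟨Q, hQ⟩ := exists_polynomial_sinSum n (fun k => -(heatCoeff a s k * k))
      refine entropy_sub_fisher_dissipation_nonneg (cosSum_heatCoeff_pos h s)
        (hasDerivAt_cosSum n _)
        (hasDerivAt_sinSum n _) (hasDerivAt_cosSum n _) (continuous_sinSum n _) hQ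
        (q₁ := fun x => Q.derivative.eval (Real.cos x) * (-Real.sin x)) (fun x => ?_) ?_
      · exact (Q.hasDerivAt (Real.cos x)).comp x (Real.hasDerivAt_cos x)
      · exact (Q.derivative.continuous.comp Real.continuous_cos).mul Real.continuous_sin.neg) hs
  have hfin := ge_of_tendsto (tendsto_entropy_cosSum_heatCoeff hn a)
    ((eventually_ge_atTop 0).mono hle)
  have hheat0 : heatCoeff a 0 = a := funext fun k => by simp [heatCoeff]
  simpa [hheat0, mul_left_comm] using hfin

/-! ### Log-Sobolev inequality for the uniform measure -/

lemma tendsto_integral_of_bounded {μ : Measure ℝ} [IsFiniteMeasure μ] {F : ℕ → ℝ → ℝ}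
    {f : ℝ → ℝ} (M : ℝ) (hm : ∀ n, AEStronglyMeasurable (F n) μ)
    (hb : ∀ n, ∀ᵐ x ∂μ, |F n x| ≤ M)
    (hl : ∀ᵐ x ∂μ, Tendsto (fun n => F n x) atTop (𝓝 (f x))) :
    Tendsto (fun n => ∫ x, F n x ∂μ) atTop (𝓝 (∫ x, f x ∂μ)) :=
  tendsto_integral_of_dominated_convergence (fun _ => M) hm (integrable_const M) hb hl

/-- The entropy is continuous under bounded almost everywhere convergence. -/
lemma tendsto_entSq {μ : Measure ℝ} [IsFiniteMeasure μ] {h : ℕ → ℝ → ℝ} {g : ℝ → ℝ} (M : ℝ)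
    (hm : ∀ n, AEStronglyMeasurable (h n) μ) (hb : ∀ n, ∀ᵐ x ∂μ, |h n x| ≤ M)
    (hl : ∀ᵐ x ∂μ, Tendsto (fun n => h n x) atTop (𝓝 (g x))) :
    Tendsto (fun n => entSq μ (h n)) atTop (𝓝 (entSq μ g)) := by
  have hsq : Tendsto (fun n => ∫ x, h n x ^ 2 ∂μ) atTop (𝓝 (∫ x, g x ^ 2 ∂μ)) := by
    refine tendsto_integral_of_bounded (M ^ 2) (fun n => (hm n).pow 2) (fun n => ?_) ?_
    · filter_upwards [hb n] with x hx
      rw [abs_pow]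
      exact pow_le_pow_left₀ (abs_nonneg _) hx 2
    · filter_upwards [hl] with x hx using hx.pow 2
  have hlog : Continuous fun y : ℝ => y ^ 2 * Real.log (y ^ 2) :=
    Real.continuous_mul_log.comp (continuous_pow 2)
  obtain ⟨K, hK⟩ := (isCompact_Icc (a := -M) (b := M)).exists_bound_of_continuousOn
    hlog.continuousOn
  refine Tendsto.sub ?_ ((Real.continuous_mul_log.tendsto _).comp hsq)
  refine tendsto_integral_of_bounded K (fun n => hlog.comp_aestronglyMeasurable (hm n))
    (fun n => ?_) ?_
  · filter_upwards [hb n] with x hx using hK _ (abs_le.1 hx)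
  · filter_upwards [hl] with x hx using (hlog.tendsto _).comp hx

lemma measurableSet_segment₀ : MeasurableSet segment₀ := measurableSet_Icc

lemma volume_segment₀ : volume segment₀ = ENNReal.ofReal Real.pi := by
  rw [segment₀, Real.volume_Icc]; congr 1; ring

lemma isProbabilityMeasure_uniform₀ : IsProbabilityMeasure uniform₀ := by
  refine cond_isProbabilityMeasure_of_finite ?_ ?_ <;> simp [volume_segment₀, Real.pi_pos]

lemma ae_uniform₀_of_forall_mem {P : ℝ → Prop} (h : ∀ x ∈ segment₀, P x) :
    ∀ᵐ x ∂uniform₀, P x := by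
  refine Measure.ae_smul_measure ?_ _
  exact (ae_restrict_iff' measurableSet_segment₀).2 (Eventually.of_forall h)

lemma ae_uniform₀_of_forall_mem_Ioo {P : ℝ → Prop}
    (h : ∀ x ∈ Set.Ioo (-(Real.pi / 2)) (Real.pi / 2), P x) : ∀ᵐ x ∂uniform₀, P x := by
  refine Measure.ae_smul_measure ?_ _
  rw [segment₀, Measure.restrict_congr_set Ioo_ae_eq_Icc.symm]
  exact (ae_restrict_iff' measurableSet_Ioo).2 (Eventually.of_forall h)

lemma integral_uniform₀ (F : ℝ → ℝ) :
    ∫ x, F x ∂uniform₀ = Real.pi⁻¹ * ∫ x in (0 : ℝ)..Real.pi, F (x - Real.pi / 2) := by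
  have hpi := Real.pi_pos
  rw [uniform₀, ProbabilityTheory.cond, integral_smul_measure, volume_segment₀, ENNReal.toReal_inv,
    ENNReal.toReal_ofReal hpi.le, smul_eq_mul, segment₀, integral_Icc_eq_integral_Ioc,
    ← intervalIntegral.integral_of_le (by linarith),
    intervalIntegral.integral_comp_sub_right]
  congr 2 <;> ring

/-- The sharp logarithmic Sobolev inequality for regularized polynomials in `sin`. -/
lemma entSq_uniform₀_sqrt_le (P : Polynomial ℝ) {ε : ℝ} (hε : 0 < ε) :
    entSq uniform₀ (fun x => √(P.eval (Real.sin x) ^ 2 + ε))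
      ≤ 2 * ∫ x, (P.derivative.eval (Real.sin x) * Real.cos x) ^ 2 ∂uniform₀ := by
  have hpi := Real.pi_pos
  set h : ℝ → ℝ := fun x => P.eval (Real.sin x) with hh
  set d : ℝ → ℝ := fun x => P.derivative.eval (Real.sin x) * Real.cos x with hd
  have hder : ∀ x, HasDerivAt h (d x) x := fun x =>
    (P.hasDerivAt (Real.sin x)).comp x (Real.hasDerivAt_sin x)
  have ch : Continuous h := continuous_iff_continuousAt.2 fun x => (hder x).continuousAt
  have cd : Continuous d := (P.derivative.continuous.comp Real.continuous_sin).mul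
    Real.continuous_cos
  -- The sign comes from `sin (x - π/2) = -cos x`. Adding `ε` makes the density strictly positive.
  obtain ⟨n, a, ha⟩ := exists_cosSum_eq ((P.comp (-Polynomial.X)) ^ 2 + Polynomial.C ε)
  have hcs : ∀ x, cosSum n a x = h (x - Real.pi / 2) ^ 2 + ε := fun x => by
    rw [← ha]; simp [hh, Real.sin_sub_pi_div_two]
  have hpos : ∀ x, 0 < cosSum n a x := fun x => by rw [hcs]; positivity
  have hn : 0 < n := by
    rcases Nat.eq_zero_or_pos n with rfl | hn
    · simpa [cosSum] using hpos 0
    · exact hn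
  have hsn : ∀ x, sinSum n (fun k => -(a k * k)) x
      = 2 * h (x - Real.pi / 2) * d (x - Real.pi / 2) := fun x => by
    have h1 := (((hder (x - Real.pi / 2)).comp x ((hasDerivAt_id x).sub_const _)).pow 2).add_const ε
    have h2 := hasDerivAt_cosSum n a x
    rw [funext hcs] at h2
    refine h2.unique (h1.congr_deriv ?_)
    simp
  have hmean := integral_cosSum n a hn
  have key := cosSum_logSobolev hpos
  simp only [hcs, hsn] at key hmean
  have c1 : Continuous fun x => (h (x - Real.pi / 2) ^ 2 + ε)
      * Real.log (h (x - Real.pi / 2) ^ 2 + ε) :=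
    Real.continuous_mul_log.comp (by fun_prop)
  have c2 : Continuous fun x => (2 * h (x - Real.pi / 2) * d (x - Real.pi / 2)) ^ 2
      / (2 * (h (x - Real.pi / 2) ^ 2 + ε)) :=
    Continuous.div (by fun_prop) (by fun_prop) fun x => by positivity
  have c3 : Continuous fun x => 2 * d (x - Real.pi / 2) ^ 2 := by fun_prop
  rw [intervalIntegral.integral_sub (c1.intervalIntegrable _ _) (c2.intervalIntegrable _ _)] at key
  -- For `p = h² + ε` one has `p'²/(2p) = 2 h² h'²/(h² + ε) ≤ 2 h'²`.
  have hle : (∫ x in (0 : ℝ)..Real.pi, (2 * h (x - Real.pi / 2) * d (x - Real.pi / 2)) ^ 2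
      / (2 * (h (x - Real.pi / 2) ^ 2 + ε))) ≤ ∫ x in (0 : ℝ)..Real.pi,
        2 * d (x - Real.pi / 2) ^ 2 := by
    refine intervalIntegral.integral_mono_on hpi.le (c2.intervalIntegrable _ _)
      (c3.intervalIntegrable _ _) fun x _ => ?_
    rw [div_le_iff₀ (by positivity)]
    have : 0 ≤ d (x - Real.pi / 2) ^ 2 * ε := by positivity
    nlinarith
  rw [intervalIntegral.integral_const_mul] at hle
  have hsq : ∀ x, √(h x ^ 2 + ε) ^ 2 = h x ^ 2 + ε := fun x => Real.sq_sqrt (by positivity)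
  change entSq uniform₀ (fun x => √(h x ^ 2 + ε)) ≤ 2 * ∫ x, d x ^ 2 ∂uniform₀
  simp only [entSq, hsq, integral_uniform₀, hmean]
  rw [inv_mul_cancel_left₀ hpi.ne']
  have : Real.pi⁻¹ * (∫ x in (0 : ℝ)..Real.pi, (h (x - Real.pi / 2) ^ 2 + ε)
      * Real.log (h (x - Real.pi / 2) ^ 2 + ε)) ≤ Real.pi⁻¹ * (Real.pi * (a 0 * Real.log (a 0))
      + 2 * ∫ x in (0 : ℝ)..Real.pi, d (x - Real.pi / 2) ^ 2) :=
    mul_le_mul_of_nonneg_left (by linarith) (by positivity)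
  rw [mul_add, inv_mul_cancel_left₀ hpi.ne'] at this
  linarith

/-- The sharp logarithmic Sobolev inequality for polynomials in `sin`. -/
lemma entSq_uniform₀_polynomial_sin_le (P : Polynomial ℝ) :
    entSq uniform₀ (fun x => P.eval (Real.sin x))
      ≤ 2 * ∫ x, (P.derivative.eval (Real.sin x) * Real.cos x) ^ 2 ∂uniform₀ := by
  have := isProbabilityMeasure_uniform₀
  have ch : Continuous fun x => P.eval (Real.sin x) := P.continuous.comp Real.continuous_sin
  obtain ⟨K, hK⟩ := (isCompact_Icc (a := -(Real.pi / 2))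
    (b := Real.pi / 2)).exists_bound_of_continuousOn ch.continuousOn
  -- As `ε → 0` the regularization tends to `|P (sin x)|`, and the entropy sees only the square.
  have e : entSq uniform₀ (fun x => P.eval (Real.sin x))
      = entSq uniform₀ (fun x => |P.eval (Real.sin x)|) := by simp [entSq]
  rw [e]
  refine le_of_tendsto (tendsto_entSq
    (h := fun n x => √(P.eval (Real.sin x) ^ 2 + 1 / ((n : ℝ) + 1)))
    √(K ^ 2 + 1) (fun n => Continuous.aestronglyMeasurable (by fun_prop))
    (fun n => ae_uniform₀_of_forall_mem fun x hx => ?_) (Eventually.of_forall fun x => ?_))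
    (Eventually.of_forall fun n => entSq_uniform₀_sqrt_le P (by positivity))
  · rw [abs_of_nonneg (Real.sqrt_nonneg _)]
    refine Real.sqrt_le_sqrt (add_le_add ?_ ?_)
    · rw [← sq_abs]
      exact pow_le_pow_left₀ (abs_nonneg _) (hK x hx) 2
    · rw [div_le_one (by positivity)]; linarith [n.cast_nonneg (α := ℝ)]
  · have h1 := (tendsto_one_div_add_atTop_nhds_zero_nat (𝕜 := ℝ)).const_add
      (P.eval (Real.sin x) ^ 2)
    have h2 := (Real.continuous_sqrt.tendsto _).comp h1
    rw [add_zero, Real.sqrt_sq_eq_abs] at h2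
    exact h2

lemma exists_polynomial_derivative_eq (Q : Polynomial ℝ) :
    ∃ P : Polynomial ℝ, P.derivative = Q := by
  induction Q using Polynomial.induction_on' with
  | add p q hp hq =>
    obtain ⟨p', rfl⟩ := hp
    obtain ⟨q', rfl⟩ := hq
    exact ⟨p' + q', by simp⟩
  | monomial n a =>
    refine ⟨Polynomial.monomial (n + 1) (a / (n + 1)), ?_⟩
    rw [Polynomial.derivative_monomial]
    have : (n : ℝ) + 1 ≠ 0 := by positivity
    simp [this]

/-- A `C¹` function on `[-π/2, π/2]` is approximated, together with its derivative, by
polynomials in `sin`. -/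
lemma exists_polynomial_sin_near {h : ℝ → ℝ}
    (hc : Continuous (deriv h)) {δ : ℝ} (hδ : 0 < δ) :
    ∃ P : Polynomial ℝ, P.eval (Real.sin (-(Real.pi / 2))) = h (-(Real.pi / 2)) ∧
      ∀ x ∈ segment₀, |P.derivative.eval (Real.sin x) * Real.cos x
        - deriv h x * (Real.cos x ^ 2 / (Real.cos x ^ 2 + δ ^ 2))| ≤ δ := by
  -- The derivative of `P (sin x)` carries a factor `cos x`, so it vanishes at `±π/2` whatever `P`
  -- is. Hence `h'` is first damped by `cos²/(cos² + δ²)`; one factor `cos` is split off and the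
  -- rest is approximated by Weierstrass in the variable `sin x`.
  set G : ℝ → ℝ := fun x => deriv h x * (Real.cos x / (Real.cos x ^ 2 + δ ^ 2)) with hG
  have cG : Continuous G :=
    hc.mul (Continuous.div (by fun_prop) (by fun_prop) fun x => by positivity)
  obtain ⟨Q, hQ⟩ := exists_polynomial_near_of_continuousOn (-1) 1 (fun y => G (Real.arcsin y))
    (cG.comp Real.continuous_arcsin).continuousOn δ hδ
  obtain ⟨P, rfl⟩ := exists_polynomial_derivative_eq Q
  refine ⟨P + Polynomial.C (h (-(Real.pi / 2)) - P.eval (Real.sin (-(Real.pi / 2)))), by simp,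
    fun x hx => ?_⟩
  have h1 := hQ (Real.sin x) ⟨Real.neg_one_le_sin x, Real.sin_le_one x⟩
  rw [Real.arcsin_sin hx.1 hx.2] at h1
  have h2 : (P + Polynomial.C (h (-(Real.pi / 2))
      - P.eval (Real.sin (-(Real.pi / 2))))).derivative = P.derivative := by simp
  have h3 : P.derivative.eval (Real.sin x) * Real.cos x
        - deriv h x * (Real.cos x ^ 2 / (Real.cos x ^ 2 + δ ^ 2))
      = (P.derivative.eval (Real.sin x) - G x) * Real.cos x := by
    simp only [hG]; ring
  rw [h2, h3, abs_mul]
  exact (mul_le_of_le_one_right (abs_nonneg _) (Real.abs_cos_le_one x)).trans h1.le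

/-- The uniform measure on an interval of length `π` satisfies the logarithmic Sobolev inequality
with constant `1`. -/
lemma satisfiesLSI_uniform₀ : SatisfiesLSI uniform₀ 1 := by
  intro h hsm _
  have := isProbabilityMeasure_uniform₀
  have hpi := Real.pi_pos
  have hdiff : Differentiable ℝ h := hsm.differentiable (by simp)
  have hc : Continuous (deriv h) := hsm.continuous_deriv (by simp)
  choose P hP0 hP using fun n : ℕ => exists_polynomial_sin_near hc
    (δ := 1 / ((n : ℝ) + 1)) (by positivity)
  set k : ℕ → ℝ → ℝ := fun n x => (P n).derivative.eval (Real.sin x) * Real.cos x with hk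
  have ck : ∀ n, Continuous (k n) := fun n =>
    ((P n).derivative.continuous.comp Real.continuous_sin).mul Real.continuous_cos
  have hkd : ∀ n x, HasDerivAt (fun x => (P n).eval (Real.sin x)) (k n x) x := fun n x =>
    ((P n).hasDerivAt (Real.sin x)).comp x (Real.hasDerivAt_sin x)
  have hδ1 : ∀ n : ℕ, 1 / ((n : ℝ) + 1) ≤ 1 := fun n => by
    rw [div_le_one (by positivity)]; linarith [n.cast_nonneg (α := ℝ)]
  obtain ⟨K, hK⟩ := (isCompact_Icc (a := -(Real.pi / 2))
    (b := Real.pi / 2)).exists_bound_of_continuousOn hc.continuousOn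
  have hkb : ∀ n, ∀ x ∈ segment₀, |k n x| ≤ K + 1 := fun n x hx => by
    have h1 := hP n x hx
    have h2 : |deriv h x * (Real.cos x ^ 2 / (Real.cos x ^ 2 + (1 / ((n : ℝ) + 1)) ^ 2))| ≤ K := by
      rw [abs_mul]
      refine (mul_le_of_le_one_right (abs_nonneg _) ?_).trans (hK x hx)
      rw [abs_of_nonneg (by positivity), div_le_one (by positivity)]
      exact le_add_of_nonneg_right (by positivity)
    have h3 := abs_sub_abs_le_abs_sub (k n x)
      (deriv h x * (Real.cos x ^ 2 / (Real.cos x ^ 2 + (1 / ((n : ℝ) + 1)) ^ 2)))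
    linarith [hδ1 n]
  have hkl : ∀ x ∈ Set.Ioo (-(Real.pi / 2)) (Real.pi / 2),
      Tendsto (fun n => k n x) atTop (𝓝 (deriv h x)) := fun x hx => by
    have hcos := Real.cos_pos_of_mem_Ioo hx
    have h0 := tendsto_one_div_add_atTop_nhds_zero_nat (𝕜 := ℝ)
    have h1 : Tendsto (fun n : ℕ => deriv h x * (Real.cos x ^ 2
        / (Real.cos x ^ 2 + (1 / ((n : ℝ) + 1)) ^ 2))) atTop (𝓝 (deriv h x)) := by
      have := ((tendsto_const_nhds (x := Real.cos x ^ 2)).div ((h0.pow 2).const_add (Real.cos x ^ 2))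
        (by simp [hcos.ne'])).const_mul (deriv h x)
      simpa [hcos.ne'] using this
    have h2 := squeeze_zero_norm (a := fun n : ℕ => 1 / ((n : ℝ) + 1))
      (f := fun n => k n x - deriv h x * (Real.cos x ^ 2
        / (Real.cos x ^ 2 + (1 / ((n : ℝ) + 1)) ^ 2))) (fun n => hP n x ⟨hx.1.le, hx.2.le⟩) h0
    simpa using h2.add h1
  have hint : ∀ x ∈ segment₀, ∀ n, (P n).eval (Real.sin x)
      = h (-(Real.pi / 2)) + ∫ y in (-(Real.pi / 2))..x, k n y := fun x _ n => by
    rw [intervalIntegral.integral_eq_sub_of_hasDerivAt (fun y _ => hkd n y)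
      ((ck n).intervalIntegrable _ _), hP0]
    ring
  have hsub : ∀ x ∈ segment₀, Set.uIoc (-(Real.pi / 2)) x ⊆ segment₀ := fun x hx y hy => by
    rw [Set.uIoc_of_le hx.1] at hy
    exact ⟨hy.1.le, hy.2.trans hx.2⟩
  have hlim : ∀ x ∈ segment₀, Tendsto (fun n => (P n).eval (Real.sin x)) atTop (𝓝 (h x)) := by
    intro x hx
    have e : h x = h (-(Real.pi / 2)) + ∫ y in (-(Real.pi / 2))..x, deriv h y := by
      rw [intervalIntegral.integral_eq_sub_of_hasDerivAt (fun y _ => (hdiff y).hasDerivAt)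
        (hc.intervalIntegrable _ _)]
      ring
    rw [e]
    simp only [hint x hx]
    refine Tendsto.const_add _ ?_
    refine intervalIntegral.tendsto_integral_filter_of_dominated_convergence (fun _ => K + 1)
      (Eventually.of_forall fun n => (ck n).aestronglyMeasurable)
      (Eventually.of_forall fun n => Eventually.of_forall fun y hy => hkb n y (hsub x hx hy))
      intervalIntegrable_const ?_
    -- The derivatives `k n` vanish at `π/2`, so they need not converge to `h'` there; the point is
    -- null.
    filter_upwards [(measure_eq_zero_iff_ae_notMem (μ := volume)
      (s := {Real.pi / 2})).1 (by simp)] with y hy hyx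
    rw [Set.uIoc_of_le hx.1] at hyx
    exact hkl y ⟨hyx.1, lt_of_le_of_ne (hyx.2.trans hx.2) hy⟩
  have hbd : ∀ n, ∀ x ∈ segment₀, |(P n).eval (Real.sin x)|
      ≤ |h (-(Real.pi / 2))| + (K + 1) * Real.pi := fun n x hx => by
    rw [hint x hx n]
    refine (abs_add_le _ _).trans (add_le_add_right ?_ _)
    have hK0 : 0 ≤ K + 1 := (abs_nonneg _).trans (hkb 0 x hx)
    refine (intervalIntegral.norm_integral_le_of_norm_le_const (f := k n) (C := K + 1)
      fun y hy => hkb n y (hsub x hx hy)).trans (mul_le_mul_of_nonneg_left ?_ hK0)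
    rw [abs_le]; constructor <;> linarith [hx.1, hx.2]
  have t1 := tendsto_entSq (μ := uniform₀) (h := fun n x => (P n).eval (Real.sin x)) (g := h) _
    (fun n => ((P n).continuous.comp Real.continuous_sin).aestronglyMeasurable)
    (fun n => ae_uniform₀_of_forall_mem (hbd n)) (ae_uniform₀_of_forall_mem hlim)
  have t2 := tendsto_integral_of_bounded (μ := uniform₀) (F := fun n x => k n x ^ 2)
    (f := fun x => deriv h x ^ 2) ((K + 1) ^ 2)
    (fun n => ((ck n).pow 2).aestronglyMeasurable)
    (fun n => ae_uniform₀_of_forall_mem fun x hx => by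
      rw [abs_pow]; exact pow_le_pow_left₀ (abs_nonneg _) (hkb n x hx) 2)
    (ae_uniform₀_of_forall_mem_Ioo fun x hx => (hkl x hx).pow 2)
  rw [mul_one]
  exact le_of_tendsto_of_tendsto' t1 (t2.const_mul 2) fun n =>
    entSq_uniform₀_polynomial_sin_le (P n)

/-! ### From log-Sobolev to Poincaré -/

/-- A logarithmic Sobolev inequality for compactly supported functions extends to smooth functions
that are bounded together with their derivatives. -/
lemma SatisfiesLSI.entSq_le_of_bounded {μ : Measure ℝ} [IsFiniteMeasure μ] {C : ℝ}
    (hμ : SatisfiesLSI μ C) {h : ℝ → ℝ} (hsm : ContDiff ℝ ∞ h) {M M' : ℝ}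
    (hM : ∀ x, |h x| ≤ M) (hM' : ∀ x, |deriv h x| ≤ M') :
    entSq μ h ≤ 2 * C * ∫ x, deriv h x ^ 2 ∂μ := by
  -- The dilated cutoffs `χ (x / (n + 1))` tend to 1 pointwise, with gradients of size `O(1/n)`.
  let χ : ContDiffBump (0 : ℝ) := ⟨1, 2, one_pos, one_lt_two⟩
  have χs : ContDiff ℝ ∞ χ := χ.contDiff
  have χc : HasCompactSupport χ := χ.hasCompactSupport
  have cχ' : Continuous (deriv χ) := χs.continuous_deriv (by simp)
  obtain ⟨B, hB⟩ := χc.deriv.exists_bound_of_continuous cχ'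
  have hB0 : 0 ≤ B := (norm_nonneg _).trans (hB 0)
  have hM0 : 0 ≤ M := (abs_nonneg _).trans (hM 0)
  have hdiff : Differentiable ℝ h := hsm.differentiable (by simp)
  have chd : Continuous (deriv h) := hsm.continuous_deriv (by simp)
  set c : ℕ → ℝ := fun n => 1 / ((n : ℝ) + 1) with hc
  have c0 : ∀ n, 0 < c n := fun n => by simp only [hc]; positivity
  have c1 : ∀ n, c n ≤ 1 := fun n => by
    simp only [hc]
    rw [div_le_one (by positivity)]; linarith [n.cast_nonneg (α := ℝ)]
  have hcl : Tendsto c atTop (𝓝 0) := tendsto_one_div_add_atTop_nhds_zero_nat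
  set u : ℕ → ℝ → ℝ := fun n x => χ (c n * x) * h x with hu
  set u' : ℕ → ℝ → ℝ := fun n x => c n * deriv χ (c n * x) * h x + χ (c n * x) * deriv h x with hu'
  have hud : ∀ n x, HasDerivAt (u n) (u' n x) x := fun n x => by
    have h1 := ((χs.differentiable (by simp) (c n * x)).hasDerivAt.comp x
      ((hasDerivAt_id x).const_mul (c n))).mul (hdiff x).hasDerivAt
    refine h1.congr_deriv ?_
    simp only [hu', Function.comp_apply, mul_one]; ring
  have husm : ∀ n, ContDiff ℝ ∞ (u n) := fun n =>
    (χs.comp (contDiff_const.mul contDiff_id)).mul hsm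
  have huc : ∀ n, HasCompactSupport (u n) := fun n =>
    (χc.comp_smul (c0 n).ne').mul_right
  have hχ1 : ∀ y, |χ y| ≤ 1 := fun y => by
    rw [abs_of_nonneg χ.nonneg]; exact χ.le_one
  have hχl : ∀ x, Tendsto (fun n => χ (c n * x)) atTop (𝓝 1) := fun x => by
    have h1 : Tendsto (fun n => c n * x) atTop (𝓝 0) := by simpa using hcl.mul_const x
    have h2 := (χs.continuous.tendsto 0).comp h1
    have h3 : χ 0 = 1 := χ.one_of_mem_closedBall (by simp [χ])
    rwa [h3] at h2
  have t1 : Tendsto (fun n => entSq μ (u n)) atTop (𝓝 (entSq μ h)) := by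
    refine tendsto_entSq M (fun n => (husm n).continuous.aestronglyMeasurable)
      (fun n => Eventually.of_forall fun x => ?_) (Eventually.of_forall fun x => ?_)
    · rw [abs_mul]
      exact (mul_le_of_le_one_left (abs_nonneg _) (hχ1 _)).trans (hM x)
    · simpa using (hχl x).mul_const (h x)
  have cu' : ∀ n, Continuous (u' n) := fun n => by
    have := χs.continuous
    have := hsm.continuous
    simp only [hu']; fun_prop
  have t2 : Tendsto (fun n => ∫ x, u' n x ^ 2 ∂μ) atTop (𝓝 (∫ x, deriv h x ^ 2 ∂μ)) := by
    refine tendsto_integral_of_bounded ((B * M + M') ^ 2)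
      (fun n => ((cu' n).pow 2).aestronglyMeasurable)
      (fun n => Eventually.of_forall fun x => ?_) (Eventually.of_forall fun x => ?_)
    · rw [abs_pow]
      refine pow_le_pow_left₀ (abs_nonneg _) ((abs_add_le _ _).trans (add_le_add ?_ ?_)) 2
      · rw [abs_mul, abs_mul, abs_of_pos (c0 n)]
        refine mul_le_mul ?_ (hM x) (abs_nonneg _) hB0
        exact (mul_le_of_le_one_left (abs_nonneg _) (c1 n)).trans (hB _)
      · rw [abs_mul]
        exact (mul_le_of_le_one_left (abs_nonneg _) (hχ1 _)).trans (hM' x)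
    · refine Tendsto.pow ?_ 2
      have h1 : Tendsto (fun n => c n * deriv χ (c n * x)) atTop (𝓝 0) := by
        refine squeeze_zero_norm (fun n => ?_) (by simpa using hcl.mul_const B)
        rw [norm_mul, Real.norm_of_nonneg (c0 n).le]
        exact mul_le_mul_of_nonneg_left (hB _) (c0 n).le
      simpa using (h1.mul_const (h x)).add ((hχl x).mul_const (deriv h x))
  refine le_of_tendsto_of_tendsto' t1 (t2.const_mul (2 * C)) fun n => ?_
  have h1 := hμ (u n) (husm n) (huc n)
  have h2 : deriv (u n) = u' n := funext fun x => (hud n x).deriv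
  rwa [h2] at h1

/-- Second-order Taylor expansion at `u = 0`. In the error, 9 comes from the logarithm's remainder,
using `(1 + u)² ≤ 9/4`, and 1 from `u⁴ ≤ |u|³`. -/
lemma two_mul_add_three_mul_sq_sub_le {u : ℝ} (hu : |u| ≤ 1 / 2) :
    2 * u + 3 * u ^ 2 - 10 * |u| ^ 3 ≤ (1 + u) ^ 2 * Real.log ((1 + u) ^ 2) := by
  have h1 := Real.abs_log_sub_add_sum_range_le (x := -u) (by rw [abs_neg]; linarith) 2
  simp only [Finset.sum_range_succ, Finset.sum_range_zero, abs_neg] at h1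
  have h2 : |u| ^ (2 + 1) / (1 - |u|) ≤ 2 * |u| ^ 3 := by
    rw [div_le_iff₀ (by linarith)]
    have : 0 ≤ |u| ^ 3 * (1 / 2 - |u|) := mul_nonneg (by positivity) (by linarith)
    norm_num
    linarith
  have h3 := (abs_le.1 (h1.trans h2)).1
  norm_num at h3
  have h4 : u - u ^ 2 / 2 - 2 * |u| ^ 3 ≤ Real.log (1 + u) := by linarith
  have hu' := abs_le.1 hu
  rw [Real.log_pow]
  have h5 : (1 + u) ^ 2 * (u - u ^ 2 / 2 - 2 * |u| ^ 3) ≤ (1 + u) ^ 2 * Real.log (1 + u) :=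
    mul_le_mul_of_nonneg_left h4 (by positivity)
  have h6 : (1 + u) ^ 2 ≤ 9 / 4 := by nlinarith
  have h7 : (1 + u) ^ 2 * (2 * |u| ^ 3) ≤ 9 / 4 * (2 * |u| ^ 3) :=
    mul_le_mul_of_nonneg_right h6 (by positivity)
  have h8 : u ^ 4 ≤ |u| ^ 3 := by
    have : u ^ 4 = |u| ^ 3 * |u| := by
      rw [← pow_succ, (by norm_num : 3 + 1 = 4), (by decide : Even 4).pow_abs]
    rw [this]
    exact mul_le_of_le_one_right (by positivity) (by linarith)
  push_cast
  nlinarith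

/-- A logarithmic Sobolev inequality implies the Poincaré inequality with the same constant. -/
lemma SatisfiesLSI.poincare {μ : Measure ℝ} [IsProbabilityMeasure μ] {C : ℝ}
    (hμ : SatisfiesLSI μ C) {g : ℝ → ℝ} (hsm : ContDiff ℝ ∞ g) {M M' : ℝ}
    (hM : ∀ x, |g x| ≤ M) (hM' : ∀ x, |deriv g x| ≤ M') (hmean : ∫ x, g x ∂μ = 0) :
    ∫ x, g x ^ 2 ∂μ ≤ C * ∫ x, deriv g x ^ 2 ∂μ := by
  have hM0 : 0 ≤ M := (abs_nonneg _).trans (hM 0)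
  have hdiff : Differentiable ℝ g := hsm.differentiable (by simp)
  have cg := hsm.continuous
  set σ := ∫ x, g x ^ 2 ∂μ with hσ
  set D := ∫ x, deriv g x ^ 2 ∂μ with hD
  have ig : Integrable g μ := Integrable.of_bound cg.aestronglyMeasurable M
    (Eventually.of_forall hM)
  have ig2 : Integrable (fun x => g x ^ 2) μ :=
    Integrable.of_bound (cg.pow 2).aestronglyMeasurable (M ^ 2) (Eventually.of_forall fun x => by
      rw [norm_pow]; exact pow_le_pow_left₀ (abs_nonneg _) (hM x) 2)
  -- Apply the inequality to `1 + ε g`. As `g` has mean zero, the entropy is `(3 - 1) ε² σ` up to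
  -- higher order: 3 from the Taylor expansion, 1 from the normalizing term. Divide by `ε²`.
  have key : ∀ᶠ ε : ℝ in 𝓝[>] 0, 2 * σ - 10 * ε * M ^ 3 - ε ^ 2 * σ ^ 2 ≤ 2 * C * D := by
    have hpos : (0 : ℝ) < 1 / (2 * (M + 1)) := by positivity
    filter_upwards [self_mem_nhdsWithin, nhdsWithin_le_nhds (Iio_mem_nhds hpos)] with ε hε hεM
    have hε0 : 0 < ε := Set.mem_Ioi.1 hε
    have hεM' : ε * M ≤ 1 / 2 := by
      have := (lt_div_iff₀ (by positivity)).1 (Set.mem_Iio.1 hεM)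
      nlinarith
    have hb : ∀ x, |ε * g x| ≤ ε * M := fun x => by
      rw [abs_mul, abs_of_pos hε0]; exact mul_le_mul_of_nonneg_left (hM x) hε0.le
    have hsm' : ContDiff ℝ ∞ (fun x => 1 + ε * g x) := contDiff_const.add (contDiff_const.mul hsm)
    have hder : ∀ x, deriv (fun x => 1 + ε * g x) x = ε * deriv g x := fun x =>
      (((hdiff x).hasDerivAt.const_mul ε).const_add 1).deriv
    have h1 := hμ.entSq_le_of_bounded hsm' (M := 1 + ε * M) (M' := ε * M')
      (fun x => (abs_add_le _ _).trans (by rw [abs_one]; linarith [hb x]))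
      (fun x => by
        rw [hder, abs_mul, abs_of_pos hε0]; exact mul_le_mul_of_nonneg_left (hM' x) hε0.le)
    simp only [hder, mul_pow, integral_const_mul, entSq] at h1
    have hm : ∫ x, (1 + ε * g x) ^ 2 ∂μ = 1 + ε ^ 2 * σ := by
      have e : ∀ x, (1 + ε * g x) ^ 2 = 1 + (2 * ε) * g x + ε ^ 2 * g x ^ 2 := fun x => by ring
      simp only [e]
      have i1 : Integrable (fun x => 1 + 2 * ε * g x) μ :=
        (integrable_const _).add (ig.const_mul _)
      rw [integral_add i1 (ig2.const_mul _),
        integral_add (integrable_const _) (ig.const_mul _), integral_const_mul,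
        integral_const_mul, hmean]
      simp [hσ]
    have hσ0 : 0 ≤ σ := integral_nonneg fun x => sq_nonneg _
    have hlog : (1 + ε ^ 2 * σ) * Real.log (1 + ε ^ 2 * σ) ≤ (1 + ε ^ 2 * σ) * (ε ^ 2 * σ) := by
      refine mul_le_mul_of_nonneg_left ?_ (by positivity)
      have := Real.log_le_sub_one_of_pos (show 0 < 1 + ε ^ 2 * σ by positivity)
      linarith
    have hent : 3 * ε ^ 2 * σ - 10 * (ε * M) ^ 3
        ≤ ∫ x, (1 + ε * g x) ^ 2 * Real.log ((1 + ε * g x) ^ 2) ∂μ := by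
      have e : ∫ x, (2 * ε * g x + 3 * ε ^ 2 * g x ^ 2 - 10 * (ε * M) ^ 3) ∂μ
          = 3 * ε ^ 2 * σ - 10 * (ε * M) ^ 3 := by
        have i1 : Integrable (fun x => 2 * ε * g x + 3 * ε ^ 2 * g x ^ 2) μ :=
          (ig.const_mul _).add (ig2.const_mul _)
        rw [integral_sub i1 (integrable_const _),
          integral_add (ig.const_mul _) (ig2.const_mul _), integral_const_mul,
          integral_const_mul, hmean]
        simp [hσ]
      rw [← e]
      have hcl : Continuous fun y : ℝ => y ^ 2 * Real.log (y ^ 2) :=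
        Real.continuous_mul_log.comp (continuous_pow 2)
      obtain ⟨K, hK⟩ := (isCompact_Icc (a := -(1 + ε * M))
        (b := 1 + ε * M)).exists_bound_of_continuousOn hcl.continuousOn
      refine integral_mono (((ig.const_mul _).add (ig2.const_mul _)).sub (integrable_const _))
        (Integrable.of_bound (hcl.comp (by fun_prop : Continuous fun x =>
          1 + ε * g x)).aestronglyMeasurable K (Eventually.of_forall fun x => hK (1 + ε * g x) ?_))
        fun x => ?_
      · have := abs_le.1 (hb x)
        constructor <;> linarith
      · refine le_trans ?_ (two_mul_add_three_mul_sq_sub_le ((hb x).trans hεM'))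
        have := pow_le_pow_left₀ (abs_nonneg _) (hb x) 3
        simp only [mul_pow] at this ⊢
        linarith
    rw [hm] at h1
    have h2 : ε ^ 2 * (2 * σ - 10 * ε * M ^ 3 - ε ^ 2 * σ ^ 2) ≤ ε ^ 2 * (2 * C * D) := by
      nlinarith
    exact le_of_mul_le_mul_left h2 (by positivity)
  have hlim : Tendsto (fun ε : ℝ => 2 * σ - 10 * ε * M ^ 3 - ε ^ 2 * σ ^ 2) (𝓝[>] 0)
      (𝓝 (2 * σ)) := by
    have : Continuous fun ε : ℝ => 2 * σ - 10 * ε * M ^ 3 - ε ^ 2 * σ ^ 2 := by fun_prop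
    have h := this.tendsto 0
    simp only [mul_zero, zero_mul, sub_zero, ne_eq, OfNat.ofNat_ne_zero, not_false_eq_true,
      zero_pow] at h
    exact h.mono_left nhdsWithin_le_nhds
  have := le_of_tendsto hlim key
  linarith

/-! ### The potential and its Polyak–Łojasiewicz constant -/

lemma infDist_segment₀ (x : ℝ) :
    Metric.infDist x segment₀ = max (x - Real.pi / 2) 0 + max (-x - Real.pi / 2) 0 := by
  have hpi := Real.pi_pos
  have hne : segment₀.Nonempty := ⟨0, by constructor <;> linarith⟩
  rcases le_total x (-(Real.pi / 2)) with h | h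
  · rw [max_eq_right (by linarith), max_eq_left (by linarith), zero_add]
    refine le_antisymm ?_ ((Metric.le_infDist hne).2 fun y hy => ?_)
    · refine (Metric.infDist_le_dist_of_mem (s := segment₀) (y := -(Real.pi / 2))
        ⟨le_rfl, by linarith⟩).trans ?_
      rw [Real.dist_eq, abs_of_nonpos (by linarith)]; linarith
    · rw [Real.dist_eq, abs_of_nonpos (by linarith [hy.1])]; linarith [hy.1]
  rcases le_total x (Real.pi / 2) with h' | h'
  · rw [max_eq_right (by linarith), max_eq_right (by linarith), add_zero]
    exact Metric.infDist_zero_of_mem ⟨h, h'⟩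
  · rw [max_eq_left (by linarith), max_eq_right (by linarith), add_zero]
    refine le_antisymm ?_ ((Metric.le_infDist hne).2 fun y hy => ?_)
    · refine (Metric.infDist_le_dist_of_mem (s := segment₀) (y := Real.pi / 2)
        ⟨by linarith, le_rfl⟩).trans ?_
      rw [Real.dist_eq, abs_of_nonneg (by linarith)]
    · rw [Real.dist_eq, abs_of_nonneg (by linarith [hy.2])]; linarith [hy.2]

/-- The two one-sided distances are never positive together; this kills the cross term when their
sum or difference is squared. -/
lemma max_sub_mul_max_neg_sub (x : ℝ) :
    max (x - Real.pi / 2) 0 * max (-x - Real.pi / 2) 0 = 0 := by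
  have hpi := Real.pi_pos
  rcases le_total x 0 with h | h
  · rw [max_eq_right (a := x - _) (by linarith), zero_mul]
  · rw [max_eq_right (a := -x - _) (by linarith), mul_zero]

lemma halfSqDist_eq (x : ℝ) :
    halfSqDist x = 1 / 2 * max (x - Real.pi / 2) 0 ^ 2 + 1 / 2 * max (-x - Real.pi / 2) 0 ^ 2 := by
  rw [halfSqDist, infDist_segment₀]
  linear_combination max_sub_mul_max_neg_sub x

lemma halfSqDist_nonneg (x : ℝ) : 0 ≤ halfSqDist x := by unfold halfSqDist; positivity

lemma halfSqDist_neg (x : ℝ) : halfSqDist (-x) = halfSqDist x := by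
  simp only [halfSqDist_eq, neg_neg]; ring

lemma continuous_halfSqDist : Continuous halfSqDist := by
  unfold halfSqDist
  exact continuous_const.mul ((Metric.continuous_infDist_pt _).pow 2)

lemma halfSqDist_of_mem {x : ℝ} (hx : x ∈ segment₀) : halfSqDist x = 0 := by
  rw [halfSqDist, Metric.infDist_zero_of_mem hx]; simp

lemma halfSqDist_pos_of_notMem {x : ℝ} (hx : x ∉ segment₀) : 0 < halfSqDist x := by
  have hne : segment₀.Nonempty := ⟨0, by constructor <;> linarith [Real.pi_pos]⟩
  have := (isClosed_Icc.notMem_iff_infDist_pos hne).1 hx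
  unfold halfSqDist; positivity

lemma hasDerivAt_half_max_sq (y : ℝ) :
    HasDerivAt (fun y : ℝ => 1 / 2 * max y 0 ^ 2) (max y 0) y := by
  rcases lt_trichotomy y 0 with h | rfl | h
  · rw [max_eq_right h.le]
    refine (hasDerivAt_const y (0 : ℝ)).congr_of_eventuallyEq ?_
    filter_upwards [Iio_mem_nhds h] with z hz
    rw [max_eq_right hz.out.le]; simp
  · rw [hasDerivAt_iff_isLittleO]
    refine Asymptotics.IsBigO.trans_isLittleO (g := fun z : ℝ => (z - 0) ^ 2) ?_ ?_
    · refine Asymptotics.IsBigO.of_bound 1 (Eventually.of_forall fun z => ?_)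
      simp only [max_self, smul_zero, sub_zero, Real.norm_eq_abs, ne_eq, OfNat.ofNat_ne_zero,
        not_false_eq_true, zero_pow, mul_zero, one_mul, abs_mul, abs_pow]
      have : |max z 0| ≤ |z| := by
        rw [abs_of_nonneg (le_max_right _ _)]
        exact max_le (le_abs_self z) (abs_nonneg z)
      have := pow_le_pow_left₀ (abs_nonneg _) this 2
      rw [abs_of_pos (by norm_num : (0 : ℝ) < 1 / 2)]
      nlinarith [sq_nonneg |z|]
    · simpa using Asymptotics.isLittleO_pow_id (𝕜 := ℝ) one_lt_two
  · rw [max_eq_left h.le]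
    refine HasDerivAt.congr_of_eventuallyEq (f₁ := fun y : ℝ => 1 / 2 * max y 0 ^ 2)
      (f := fun y => 1 / 2 * y ^ 2) ?_ ?_
    · exact ((hasDerivAt_pow 2 y).const_mul (1 / 2)).congr_deriv (by simp)
    · filter_upwards [Ioi_mem_nhds h] with z hz
      rw [max_eq_left hz.out.le]

lemma hasDerivAt_halfSqDist (x : ℝ) :
    HasDerivAt halfSqDist (max (x - Real.pi / 2) 0 - max (-x - Real.pi / 2) 0) x := by
  rw [funext halfSqDist_eq]
  have h1 := (hasDerivAt_half_max_sq (x - Real.pi / 2)).comp x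
    ((hasDerivAt_id x).sub_const (Real.pi / 2))
  have h2 := (hasDerivAt_half_max_sq (-x - Real.pi / 2)).comp x
    ((hasDerivAt_id x).neg.sub_const (Real.pi / 2))
  exact (h1.add h2).congr_deriv (by ring)

lemma contDiff_halfSqDist : ContDiff ℝ 1 halfSqDist := by
  rw [contDiff_one_iff_deriv]
  refine ⟨fun x => (hasDerivAt_halfSqDist x).differentiableAt, ?_⟩
  rw [funext fun x => (hasDerivAt_halfSqDist x).deriv]
  fun_prop

lemma isLeast_satisfiesPL_halfSqDist : IsLeast {C : ℝ | SatisfiesPL halfSqDist C} (1 / 2) := by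
  have hpi := Real.pi_pos
  have hinf : ⨅ y, halfSqDist y = 0 := by
    refine le_antisymm ?_ (Real.iInf_nonneg halfSqDist_nonneg)
    refine (ciInf_le ⟨0, ?_⟩ 0).trans (halfSqDist_of_mem ⟨by linarith, by linarith⟩).le
    rintro _ ⟨y, rfl⟩
    exact halfSqDist_nonneg y
  constructor
  · intro x
    rw [hinf, (hasDerivAt_halfSqDist x).deriv, halfSqDist_eq]
    linarith [max_sub_mul_max_neg_sub x, sub_sq (max (x - Real.pi / 2) 0)
      (max (-x - Real.pi / 2) 0)]
  · intro C hC
    -- At distance 1 from the segment the potential is `1/2` and its slope is 1.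
    have h := hC (Real.pi / 2 + 1)
    rw [hinf, (hasDerivAt_halfSqDist _).deriv, halfSqDist_eq, max_eq_right (a := -_ - _)
      (by linarith), max_eq_left (by linarith)] at h
    norm_num at h
    linarith

/-! ### Gibbs measures: normalization and weak limit -/

lemma exp_neg_halfSqDist_le_one {t : ℝ} (ht : 0 < t) (x : ℝ) :
    Real.exp (-halfSqDist x / t) ≤ 1 := by
  rw [Real.exp_le_one_iff, neg_div]
  have := div_nonneg (halfSqDist_nonneg x) ht.le
  linarith

/-- Integrals against the unnormalized Gibbs weight of functions equal to `1` off the segment. -/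
lemma integral_mul_exp_neg_halfSqDist {t : ℝ} (ht : 0 < t) {G : ℝ → ℝ} (hG : Continuous G)
    (hG1 : ∀ x ∉ segment₀, G x = 1) :
    Integrable (fun x => G x * Real.exp (-halfSqDist x / t)) ∧
    ∫ x, G x * Real.exp (-halfSqDist x / t)
      = (∫ x in (-(Real.pi / 2))..(Real.pi / 2), G x) + √(2 * Real.pi * t) := by
  have hpi := Real.pi_pos
  -- The weight is 1 on the segment and a half-Gaussian of variance `t` on each side; the two halves
  -- have total mass `√(2πt)`.
  set φ : ℝ → ℝ := (Set.Ioi 0).indicator fun y => Real.exp (-(1 / (2 * t)) * y ^ 2) with hφ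
  have iφ : Integrable φ := (integrable_exp_neg_mul_sq (by positivity)).indicator measurableSet_Ioi
  have iφ1 : Integrable fun x => φ (x - Real.pi / 2) := iφ.comp_sub_right _
  have iφ2 : Integrable fun x => φ (-x - Real.pi / 2) := iφ1.comp_neg
  have iS : Integrable (segment₀.indicator G) :=
    (hG.integrableOn_Icc).integrable_indicator measurableSet_segment₀
  have e : (fun x => G x * Real.exp (-halfSqDist x / t))
      = fun x => segment₀.indicator G x + φ (x - Real.pi / 2) + φ (-x - Real.pi / 2) := by
    funext x
    by_cases hx : x ∈ segment₀
    · have h1 : φ (x - Real.pi / 2) = 0 :=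
        Set.indicator_of_notMem (by simp only [Set.mem_Ioi]; linarith [hx.2]) _
      have h2 : φ (-x - Real.pi / 2) = 0 :=
        Set.indicator_of_notMem (by simp only [Set.mem_Ioi]; linarith [hx.1]) _
      rw [h1, h2, halfSqDist_of_mem hx, Set.indicator_of_mem hx]; simp
    · rw [hG1 x hx, Set.indicator_of_notMem hx, halfSqDist_eq]
      rcases lt_or_ge (Real.pi / 2) x with h | h
      · have h1 : φ (x - Real.pi / 2) = _ :=
          Set.indicator_of_mem (by simp only [Set.mem_Ioi]; linarith) _
        have h2 : φ (-x - Real.pi / 2) = 0 :=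
          Set.indicator_of_notMem (by simp only [Set.mem_Ioi]; linarith) _
        rw [h1, h2, max_eq_left (by linarith), max_eq_right (by linarith), zero_add, add_zero,
          one_mul]
        congr 1; field_simp; ring
      · have h' : x < -(Real.pi / 2) := by
          by_contra hc
          exact hx ⟨not_lt.1 hc, h⟩
        have h1 : φ (-x - Real.pi / 2) = _ :=
          Set.indicator_of_mem (by simp only [Set.mem_Ioi]; linarith) _
        have h2 : φ (x - Real.pi / 2) = 0 :=
          Set.indicator_of_notMem (by simp only [Set.mem_Ioi]; linarith) _
        rw [h1, h2, max_eq_right (by linarith), max_eq_left (by linarith), zero_add, zero_add,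
          one_mul]
        congr 1; field_simp; ring
  have iSφ : Integrable fun x => segment₀.indicator G x + φ (x - Real.pi / 2) := iS.add iφ1
  have hφI : ∫ y, φ y = √(2 * Real.pi * t) / 2 := by
    rw [hφ, integral_indicator measurableSet_Ioi, integral_gaussian_Ioi]
    congr 2; field_simp
  have hφ1 : ∫ x, φ (x - Real.pi / 2) = √(2 * Real.pi * t) / 2 := by
    rw [integral_sub_right_eq_self, hφI]
  have hφ2 : ∫ x, φ (-x - Real.pi / 2) = √(2 * Real.pi * t) / 2 := by
    rw [integral_neg_eq_self (fun x => φ (x - Real.pi / 2)), hφ1]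
  rw [e]
  refine ⟨iSφ.add iφ2, ?_⟩
  rw [integral_add iSφ iφ2, integral_add iS iφ1, hφ1, hφ2, integral_indicator
    measurableSet_segment₀, segment₀, integral_Icc_eq_integral_Ioc,
    ← intervalIntegral.integral_of_le (by linarith)]
  ring

lemma integrable_exp_neg_halfSqDist {t : ℝ} (ht : 0 < t) :
    Integrable fun x => Real.exp (-halfSqDist x / t) := by
  simpa using (integral_mul_exp_neg_halfSqDist ht (G := fun _ => 1) continuous_const
    fun _ _ => rfl).1

lemma integral_exp_neg_halfSqDist {t : ℝ} (ht : 0 < t) :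
    ∫ x, Real.exp (-halfSqDist x / t) = Real.pi + √(2 * Real.pi * t) := by
  have := (integral_mul_exp_neg_halfSqDist ht (G := fun _ => 1) continuous_const
    fun _ _ => rfl).2
  simpa using this

lemma integral_exp_neg_halfSqDist_pos {t : ℝ} (ht : 0 < t) :
    0 < ∫ x, Real.exp (-halfSqDist x / t) := by
  rw [integral_exp_neg_halfSqDist ht]
  have := Real.pi_pos
  positivity

lemma isProbabilityMeasure_gibbs_halfSqDist {t : ℝ} (ht : 0 < t) :
    IsProbabilityMeasure (gibbs halfSqDist t) := by
  have hZ := integral_exp_neg_halfSqDist_pos ht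
  constructor
  rw [gibbs, withDensity_apply _ MeasurableSet.univ, Measure.restrict_univ,
    ← ofReal_integral_eq_lintegral_ofReal ((integrable_exp_neg_halfSqDist ht).div_const _)
      (Eventually.of_forall fun x => by positivity), integral_div, div_self hZ.ne']
  simp

lemma integral_gibbs_halfSqDist {t : ℝ} (ht : 0 < t) (F : ℝ → ℝ) :
    ∫ x, F x ∂(gibbs halfSqDist t)
      = (∫ x, F x * Real.exp (-halfSqDist x / t)) / ∫ y, Real.exp (-halfSqDist y / t) := by
  have hZ := integral_exp_neg_halfSqDist_pos ht
  have hc := continuous_halfSqDist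
  rw [gibbs, integral_withDensity_eq_integral_toReal_smul
    (Continuous.measurable (by fun_prop)).ennreal_ofReal
    (Eventually.of_forall fun x => ENNReal.ofReal_lt_top), ← integral_div]
  refine integral_congr_ae (Eventually.of_forall fun x => ?_)
  simp only [smul_eq_mul]
  rw [ENNReal.toReal_ofReal (by positivity)]
  ring

/-- The Gibbs measures converge weakly to the uniform measure. -/
lemma tendsto_integral_gibbs_halfSqDist (g : BoundedContinuousFunction ℝ ℝ) :
    Tendsto (fun t : ℝ => ∫ x, g x ∂(gibbs halfSqDist t)) (𝓝[>] 0)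
      (𝓝 (∫ x, g x ∂uniform₀)) := by
  have hpi := Real.pi_pos
  have hc := continuous_halfSqDist
  have hpt : ∀ x, Tendsto (fun t : ℝ => Real.exp (-halfSqDist x / t)) (𝓝[>] 0)
      (𝓝 (segment₀.indicator 1 x)) := fun x => by
    by_cases hx : x ∈ segment₀
    · simp [halfSqDist_of_mem hx, hx]
    · rw [Set.indicator_of_notMem hx]
      have h1 : Tendsto (fun t : ℝ => halfSqDist x * t⁻¹) (𝓝[>] 0) atTop :=
        tendsto_inv_nhdsGT_zero.const_mul_atTop (halfSqDist_pos_of_notMem hx)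
      refine (Real.tendsto_exp_neg_atTop_nhds_zero.comp h1).congr fun t => ?_
      simp [div_eq_mul_inv]
  have hnum : Tendsto (fun t : ℝ => ∫ x, g x * Real.exp (-halfSqDist x / t)) (𝓝[>] 0)
      (𝓝 (∫ x, g x * segment₀.indicator 1 x)) := by
    refine tendsto_integral_filter_of_dominated_convergence
      (fun x => ‖g‖ * Real.exp (-halfSqDist x / 1))
      (Eventually.of_forall fun t => Continuous.aestronglyMeasurable (by fun_prop)) ?_
      ((integrable_exp_neg_halfSqDist one_pos).const_mul _)
      (Eventually.of_forall fun x => (hpt x).const_mul _)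
    filter_upwards [self_mem_nhdsWithin, nhdsWithin_le_nhds (Iio_mem_nhds one_pos)] with t ht ht1
    refine Eventually.of_forall fun x => ?_
    rw [norm_mul, Real.norm_of_nonneg (Real.exp_pos _).le]
    refine mul_le_mul (g.norm_coe_le_norm x) (Real.exp_le_exp.2 ?_) (Real.exp_pos _).le
      (norm_nonneg _)
    rw [neg_div, neg_div]
    exact neg_le_neg (div_le_div_of_nonneg_left (halfSqDist_nonneg x) ht ht1.out.le)
  have hden : Tendsto (fun t : ℝ => ∫ x, Real.exp (-halfSqDist x / t)) (𝓝[>] 0) (𝓝 Real.pi) := by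
    have h1 : Continuous fun t : ℝ => Real.pi + √(2 * Real.pi * t) := by fun_prop
    have h2 := (h1.tendsto 0).mono_left (nhdsWithin_le_nhds (s := Set.Ioi 0))
    simp only [mul_zero, Real.sqrt_zero, add_zero] at h2
    refine h2.congr' ?_
    filter_upwards [self_mem_nhdsWithin] with t ht using (integral_exp_neg_halfSqDist ht).symm
  have e : ∫ x, g x ∂uniform₀ = (∫ x, g x * segment₀.indicator 1 x) / Real.pi := by
    rw [uniform₀, ProbabilityTheory.cond, integral_smul_measure, volume_segment₀,
      ENNReal.toReal_inv, ENNReal.toReal_ofReal hpi.le, ← integral_indicator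
      measurableSet_segment₀, smul_eq_mul, div_eq_inv_mul]
    congr 2
    funext x
    by_cases hx : x ∈ segment₀ <;> simp [hx]
  rw [e]
  refine (hnum.div hden hpi.ne').congr' ?_
  filter_upwards [self_mem_nhdsWithin] with t ht using (integral_gibbs_halfSqDist ht _).symm

/-! ### Stopped sine and the lower bound -/

/-- A smooth odd approximation of `sin`, stopped at `±π/2`. -/
lemma exists_smooth_stopped_sin {δ : ℝ} (hδ : 0 < δ) (hδ' : δ < Real.pi / 2) :
    ∃ g : ℝ → ℝ, ContDiff ℝ ∞ g ∧ (∀ x, g (-x) = -g x) ∧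
      (∀ x, deriv g x ^ 2 ≤ segment₀.indicator (fun x => Real.cos x ^ 2) x) ∧
      (∃ M, ∀ x, |g x| ≤ M) ∧
      ∀ x, Real.cos δ ^ 2 * Real.sin (min |x| (Real.pi / 2)) ^ 2 ≤ g x ^ 2 := by
  have hpi := Real.pi_pos
  -- The stopped sine is not smooth at `±π/2`, so its derivative `cos` is cut off within `δ` of
  -- these points, then integrated from 0.
  let χ : ContDiffBump (0 : ℝ) := ⟨Real.pi / 2 - δ, Real.pi / 2, by linarith, by linarith⟩
  have χs : ContDiff ℝ ∞ χ := χ.contDiff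
  set k : ℝ → ℝ := fun x => χ x * Real.cos x with hk
  have ks : ContDiff ℝ ∞ k := χs.mul Real.contDiff_cos
  have ck : Continuous k := ks.continuous
  have hk0 : ∀ x ∉ segment₀, k x = 0 := fun x hx => by
    have : χ x = 0 := χ.zero_of_le_dist (by
      by_contra hc
      rw [not_le, Real.dist_eq, sub_zero, abs_lt] at hc
      exact hx ⟨hc.1.le, hc.2.le⟩)
    simp [hk, this]
  have hkn : ∀ x, 0 ≤ k x := fun x => by
    by_cases hx : x ∈ segment₀
    · exact mul_nonneg χ.nonneg (Real.cos_nonneg_of_mem_Icc hx)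
    · exact (hk0 x hx).ge
  have hkeven : ∀ x, k (-x) = k x := fun x => by simp [hk, χ.neg]
  set g : ℝ → ℝ := fun x => ∫ y in (0 : ℝ)..x, k y with hg
  have hgd : ∀ x, HasDerivAt g (k x) x := fun x =>
    intervalIntegral.integral_hasDerivAt_right (ck.intervalIntegrable _ _)
      (ck.stronglyMeasurableAtFilter _ _) ck.continuousAt
  have hgd' : deriv g = k := funext fun x => (hgd x).deriv
  have hodd : ∀ x, g (-x) = -g x := fun x => by
    have h1 := intervalIntegral.integral_comp_neg (a := 0) (b := -x) k
    simp only [hkeven, neg_neg, neg_zero] at h1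
    simp only [hg]
    rw [h1, intervalIntegral.integral_symm]
  have hmono : Monotone g := monotone_of_deriv_nonneg (fun x => (hgd x).differentiableAt)
    fun x => by rw [hgd']; exact hkn x
  have hsin : ∀ x, 0 ≤ x → x ≤ Real.pi / 2 - δ → g x = Real.sin x := fun x hx hx' => by
    have h1 : g x = ∫ y in (0 : ℝ)..x, Real.cos y := by
      refine intervalIntegral.integral_congr fun y hy => ?_
      rw [Set.uIcc_of_le hx] at hy
      have : χ y = 1 := χ.one_of_mem_closedBall (by
        rw [mem_closedBall_zero_iff, Real.norm_of_nonneg hy.1]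
        exact hy.2.trans hx')
      simp [hk, this]
    rw [h1, integral_cos, Real.sin_zero, sub_zero]
  have hcosδ : 0 < Real.cos δ := Real.cos_pos_of_mem_Ioo ⟨by linarith, hδ'⟩
  -- Up to `π/2 - δ` the function is `sin` itself. Beyond, monotonicity keeps it above `sin (π/2 -
  -- δ) = cos δ`.
  have hlow : ∀ x, 0 ≤ x → Real.cos δ * Real.sin (min x (Real.pi / 2)) ≤ g x := fun x hx => by
    rcases le_total x (Real.pi / 2 - δ) with h | h
    · rw [hsin x hx h, min_eq_left (by linarith)]
      exact mul_le_of_le_one_left (Real.sin_nonneg_of_nonneg_of_le_pi hx (by linarith))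
        (Real.cos_le_one δ)
    · refine (mul_le_of_le_one_right hcosδ.le (Real.sin_le_one _)).trans ?_
      rw [← Real.sin_pi_div_two_sub, ← hsin _ (by linarith) le_rfl]
      exact hmono h
  have hsq : ∀ x, g |x| ^ 2 = g x ^ 2 := fun x => by
    rcases abs_choice x with h | h <;> rw [h]
    rw [hodd, neg_sq]
  refine ⟨g, ?_, hodd, fun x => ?_, ?_, fun x => ?_⟩
  · rw [contDiff_infty_iff_deriv, hgd']
    exact ⟨fun x => (hgd x).differentiableAt, ks⟩
  · rw [hgd']
    by_cases hx : x ∈ segment₀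
    · rw [Set.indicator_of_mem hx, hk, mul_pow]
      exact mul_le_of_le_one_left (sq_nonneg _) (pow_le_one₀ χ.nonneg χ.le_one)
    · rw [Set.indicator_of_notMem hx, hk0 x hx]; simp
  · have hconst : ∀ x, Real.pi / 2 ≤ x → g x = g (Real.pi / 2) := fun x hx => by
      have h1 : g x - g (Real.pi / 2) = ∫ y in (Real.pi / 2)..x, k y :=
        intervalIntegral.integral_interval_sub_left (ck.intervalIntegrable _ _)
          (ck.intervalIntegrable _ _)
      have h2 : ∫ y in (Real.pi / 2)..x, k y = 0 := by
        rw [intervalIntegral.integral_of_le hx]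
        refine setIntegral_eq_zero_of_forall_eq_zero fun y hy => hk0 y fun hc => ?_
        exact absurd hc.2 (not_le.2 hy.1)
      linarith
    have h0 : g 0 = 0 := by simp [hg]
    refine ⟨g (Real.pi / 2), fun x => ?_⟩
    have hg0 : 0 ≤ g (Real.pi / 2) := h0 ▸ hmono (by positivity : (0 : ℝ) ≤ Real.pi / 2)
    rw [← abs_of_nonneg hg0, ← sq_le_sq, ← hsq x]
    refine pow_le_pow_left₀ (h0 ▸ hmono (abs_nonneg x)) ?_ 2
    rcases le_total |x| (Real.pi / 2) with h | h
    · exact hmono h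
    · exact (hconst _ h).le
  · rw [← mul_pow, ← hsq x]
    refine pow_le_pow_left₀ (mul_nonneg hcosδ.le (Real.sin_nonneg_of_nonneg_of_le_pi
      (by positivity) ((min_le_right _ _).trans (by linarith)))) (hlow _ (abs_nonneg x)) 2

/-- The logarithmic Sobolev constant of the Gibbs measure is at least `1 + √(8 t / π)`. -/
lemma SatisfiesLSI.one_add_sqrt_le {t C : ℝ} (ht : 0 < t)
    (hC : SatisfiesLSI (gibbs halfSqDist t) C) : 1 + √(8 * t / Real.pi) ≤ C := by
  have hpi := Real.pi_pos
  have := isProbabilityMeasure_gibbs_halfSqDist ht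
  have hZ := integral_exp_neg_halfSqDist_pos ht
  have key : ∀ δ, 0 < δ → δ < Real.pi / 2 →
      Real.cos δ ^ 2 * (Real.pi / 2 + √(2 * Real.pi * t)) ≤ C * (Real.pi / 2) := by
    intro δ hδ hδ'
    obtain ⟨g, gs, godd, gd, ⟨M, gM⟩, glow⟩ := exists_smooth_stopped_sin hδ hδ'
    have gd1 : ∀ x, deriv g x ^ 2 ≤ 1 := fun x => (gd x).trans
      (Set.indicator_le' (fun y _ => by simpa using Real.cos_sq_le_one y)
        (fun y _ => zero_le_one) x)
    have hmean : ∫ x, g x ∂(gibbs halfSqDist t) = 0 := by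
      rw [integral_gibbs_halfSqDist ht]
      have h1 := integral_neg_eq_self (fun x => g x * Real.exp (-halfSqDist x / t)) volume
      simp only [godd, halfSqDist_neg, neg_mul, integral_neg] at h1
      have h2 : ∫ x, g x * Real.exp (-halfSqDist x / t) = 0 := by linarith
      rw [h2, zero_div]
    have h := hC.poincare gs gM (M' := 1) (fun x => (sq_le_one_iff_abs_le_one _).1 (gd1 x)) hmean
    rw [integral_gibbs_halfSqDist ht, integral_gibbs_halfSqDist ht, ← mul_div_assoc,
      div_le_div_iff_of_pos_right hZ] at h
    have iw := integrable_exp_neg_halfSqDist ht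
    have cg := gs.continuous
    have cgd : Continuous (deriv g) := gs.continuous_deriv (by simp)
    obtain ⟨iG, hG⟩ := integral_mul_exp_neg_halfSqDist ht
      (G := fun x => Real.sin (min |x| (Real.pi / 2)) ^ 2) (by fun_prop) (fun x hx => by
        have : Real.pi / 2 ≤ |x| := by
          by_contra hc
          have := abs_lt.1 (not_le.1 hc)
          exact hx ⟨this.1.le, this.2.le⟩
        rw [min_eq_right this, Real.sin_pi_div_two, one_pow])
    have hsin : ∫ x in (-(Real.pi / 2))..(Real.pi / 2), Real.sin (min |x| (Real.pi / 2)) ^ 2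
        = Real.pi / 2 := by
      have e : ∫ x in (-(Real.pi / 2))..(Real.pi / 2), Real.sin (min |x| (Real.pi / 2)) ^ 2
          = ∫ x in (-(Real.pi / 2))..(Real.pi / 2), Real.sin x ^ 2 := by
        refine intervalIntegral.integral_congr fun x hx => ?_
        rw [Set.uIcc_of_le (by linarith)] at hx
        rw [min_eq_left (abs_le.2 hx)]
        rcases abs_choice x with h | h <;> rw [h]
        rw [Real.sin_neg, neg_sq]
      rw [e, integral_sin_sq]
      simp
    have hlow : Real.cos δ ^ 2 * (Real.pi / 2 + √(2 * Real.pi * t))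
        ≤ ∫ x, g x ^ 2 * Real.exp (-halfSqDist x / t) := by
      rw [← hsin, ← hG, ← integral_const_mul]
      refine integral_mono (iG.const_mul _) ?_ fun x => ?_
      · refine iw.bdd_mul (c := M ^ 2) (cg.pow 2).aestronglyMeasurable
          (Eventually.of_forall fun x => ?_)
        rw [norm_pow]
        exact pow_le_pow_left₀ (abs_nonneg _) (gM x) 2
      · simp only
        rw [← mul_assoc]
        exact mul_le_mul_of_nonneg_right (glow x) (Real.exp_pos _).le
    have hup : ∫ x, deriv g x ^ 2 * Real.exp (-halfSqDist x / t) ≤ Real.pi / 2 := by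
      have e : ∫ x, segment₀.indicator (fun x => Real.cos x ^ 2) x = Real.pi / 2 := by
        rw [integral_indicator measurableSet_segment₀, segment₀, integral_Icc_eq_integral_Ioc,
          ← intervalIntegral.integral_of_le (by linarith), integral_cos_sq]
        simp
      rw [← e]
      refine integral_mono ?_ ?_ fun x => ?_
      · refine iw.bdd_mul (c := 1) (cgd.pow 2).aestronglyMeasurable
          (Eventually.of_forall fun x => ?_)
        rw [Real.norm_of_nonneg (sq_nonneg _)]
        exact gd1 x
      · exact (Real.continuous_cos.pow 2).integrableOn_Icc.integrable_indicator
          measurableSet_segment₀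
      · exact (mul_le_of_le_one_right (sq_nonneg _) (exp_neg_halfSqDist_le_one ht x)).trans (gd x)
    have hcos : 0 < Real.cos δ := Real.cos_pos_of_mem_Ioo ⟨by linarith, hδ'⟩
    have hD : 0 ≤ ∫ x, deriv g x ^ 2 * Real.exp (-halfSqDist x / t) :=
      integral_nonneg fun x => by positivity
    have hpos : 0 < Real.cos δ ^ 2 * (Real.pi / 2 + √(2 * Real.pi * t)) := by positivity
    -- The sign of `C` is not part of `SatisfiesLSI`, yet replacing the energy by its upper bound
    -- requires it. It follows from the positive variance.
    have hC0 : 0 ≤ C := by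
      by_contra hc
      have := mul_nonpos_of_nonpos_of_nonneg (not_le.1 hc).le hD
      linarith
    exact hlow.trans (h.trans (mul_le_mul_of_nonneg_left hup hC0))
  have hlim : Tendsto (fun δ => Real.cos δ ^ 2 * (Real.pi / 2 + √(2 * Real.pi * t))) (𝓝[>] 0)
      (𝓝 (Real.pi / 2 + √(2 * Real.pi * t))) := by
    have h1 : Continuous fun δ => Real.cos δ ^ 2 * (Real.pi / 2 + √(2 * Real.pi * t)) := by
      fun_prop
    have h2 := (h1.tendsto 0).mono_left (nhdsWithin_le_nhds (s := Set.Ioi 0))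
    simpa using h2
  have hfin : Real.pi / 2 + √(2 * Real.pi * t) ≤ C * (Real.pi / 2) := by
    refine le_of_tendsto hlim ?_
    filter_upwards [self_mem_nhdsWithin, nhdsWithin_le_nhds (Iio_mem_nhds (half_pos hpi))]
      with δ h1 h2 using key δ h1 h2
  have hs : √(8 * t / Real.pi) * (Real.pi / 2) = √(2 * Real.pi * t) := by
    rw [← Real.sqrt_sq (half_pos hpi).le, ← Real.sqrt_mul (by positivity)]
    congr 1; field_simp; ring
  have : (1 + √(8 * t / Real.pi)) * (Real.pi / 2) ≤ C * (Real.pi / 2) := by linarith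
  exact le_of_mul_le_mul_right this (half_pos hpi)

/-! ### Comparison of the two constants -/

lemma logSobolevConst_uniform₀_le_one : logSobolevConst uniform₀ ≤ (1 : ℝ) :=
  iInf₂_le 1 satisfiesLSI_uniform₀

lemma le_logSobolevConst_gibbs_halfSqDist {t : ℝ} (ht : 0 < t) :
    ((1 + √(8 * t / Real.pi) : ℝ) : EReal) ≤ logSobolevConst (gibbs halfSqDist t) :=
  le_iInf₂ fun _ hC => EReal.coe_le_coe_iff.2 (hC.one_add_sqrt_le ht)

/-- The quotient is at least `√(8t/π) / t = √(8/π) √(1/t)`. -/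
lemma tendsto_logSobolevConst_quotient :
    Tendsto (fun t : ℝ =>
        (logSobolevConst (gibbs halfSqDist t) - logSobolevConst uniform₀) / (t : EReal))
      (𝓝[>] 0) (𝓝 ⊤) := by
  have hpi := Real.pi_pos
  have h1 : Tendsto (fun t : ℝ => √(8 / Real.pi) * √(t⁻¹)) (𝓝[>] 0) atTop :=
    (Real.tendsto_sqrt_atTop.comp tendsto_inv_nhdsGT_zero).const_mul_atTop (by positivity)
  have h2 : Tendsto (fun t : ℝ => ((√(8 / Real.pi) * √(t⁻¹) : ℝ) : EReal)) (𝓝[>] 0) (𝓝 ⊤) :=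
    EReal.tendsto_coe_nhds_top_iff.2 h1
  refine tendsto_of_tendsto_of_tendsto_of_le_of_le' h2 tendsto_const_nhds ?_
    (Eventually.of_forall fun _ => le_top)
  filter_upwards [self_mem_nhdsWithin] with t ht
  have ht0 : 0 < t := ht
  have h3 := EReal.sub_le_sub (le_logSobolevConst_gibbs_halfSqDist ht0)
    logSobolevConst_uniform₀_le_one
  rw [← EReal.coe_sub, add_sub_cancel_left] at h3
  refine le_trans (le_of_eq ?_) (EReal.div_le_div_right_of_nonneg (by exact_mod_cast ht0.le) h3)
  rw [← EReal.coe_div, EReal.coe_eq_coe_iff, eq_div_iff ht0.ne', mul_assoc, mul_div_right_comm,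
    Real.sqrt_mul (by positivity)]
  congr 1
  rw [Real.sqrt_inv]
  field_simp
  exact (Real.sq_sqrt ht0.le).symm

theorem proposition3p1 :
    -- the measures are probability measures, and the constant of the limit measure is finite
    (∀ t : ℝ, 0 < t → IsProbabilityMeasure (gibbs halfSqDist t)) ∧
    IsProbabilityMeasure uniform₀ ∧
    logSobolevConst uniform₀ ≠ ⊤ ∧
    -- the lower bound `C_LS(μ_t) ≥ C_LS(μ_0) + √(8t/π) + o(√t)` as `t → 0⁺`
    (∃ r : ℝ → ℝ, r =o[𝓝[>] (0 : ℝ)] (fun t => √t) ∧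
      ∀ t : ℝ, 0 < t →
        logSobolevConst uniform₀ + ((√(8 * t / Real.pi) + r t : ℝ) : EReal)
          ≤ logSobolevConst (gibbs halfSqDist t)) ∧
    -- the potential satisfies the hypotheses of the conjecture, with best constant `C_PL = 1/2`
    ContDiff ℝ 1 halfSqDist ∧
    IsLeast {C : ℝ | SatisfiesPL halfSqDist C} (1 / 2) ∧
    (∀ g : BoundedContinuousFunction ℝ ℝ,
      Tendsto (fun t : ℝ => ∫ x, g x ∂(gibbs halfSqDist t)) (𝓝[>] 0)
        (𝓝 (∫ x, g x ∂uniform₀))) ∧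
    -- the conjectured limit `(C_LS(μ_t) - C_LS(μ_0)) / t → 2 C_PL` fails: the quotient blows up
    Tendsto (fun t : ℝ =>
        (logSobolevConst (gibbs halfSqDist t) - logSobolevConst uniform₀) / (t : EReal))
      (𝓝[>] 0) (𝓝 ⊤) ∧
    ¬ Tendsto (fun t : ℝ =>
        (logSobolevConst (gibbs halfSqDist t) - logSobolevConst uniform₀) / (t : EReal))
      (𝓝[>] 0) (𝓝 ((2 * (1 / 2) : ℝ) : EReal)) := by
  have hq := tendsto_logSobolevConst_quotient
  -- The lower bound holds exactly for every `t > 0`, so the remainder can be zero.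
  refine ⟨fun t ht => isProbabilityMeasure_gibbs_halfSqDist ht, isProbabilityMeasure_uniform₀,
    (logSobolevConst_uniform₀_le_one.trans_lt (EReal.coe_lt_top 1)).ne,
    ⟨fun _ => 0, Asymptotics.isLittleO_zero _ _, fun t ht => ?_⟩, contDiff_halfSqDist,
    isLeast_satisfiesPL_halfSqDist, tendsto_integral_gibbs_halfSqDist, hq, fun hq' => ?_⟩
  · refine (add_le_add_left logSobolevConst_uniform₀_le_one _).trans ?_
    rw [add_zero, ← EReal.coe_add]
    exact le_logSobolevConst_gibbs_halfSqDist ht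
  · exact EReal.coe_ne_top _ (tendsto_nhds_unique hq' hq)
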